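/- Let $M$ be a connected closed smooth $n$-manifold, $\mathcal L$ a smooth principal $U(1)$-bundle over $M$, $g$ a smooth Riemannian metric on $M$, $A$ a smooth connection on $\mathcal L$ with curvature $F$ (regarded as a real $2$-form on $M$, with $\mathfrak u(1)=i\mathbb R\cong\mathbb R$), and $\lambda\in\mathbb R$. The tuple $(M,\mathcal L,g,F,\lambda)$ is called an Einstein Yang–Mills (EYM) system if $$\mathrm{Ric}-\tfrac12\eta=\lambda g,\qquad d^*F=0,\qquad\text{where } \eta_{ij}=g^{kl}F_{ik}F_{jl}.$$ Norms of tensors are the full tensor norms: $|F|^2=F_{ij}F^{ij}$, $|\nabla F|^2=\nabla_kF_{ij}\nabla^kF^{ij}$, $|\mathrm{Rm}|^2=R_{ijkl}R^{ijkl}$; $\nabla$ is the Levi-Civita connection and $d\mu$ the Riemannian volume; $\|\mathrm{Rm}\|_{L^p}=\left(\int_M|\mathrm{Rm}|^p\,d\mu\right)^{1/p}$ and $\|F\|_{W^{1,q}}=\left(\int_M|F|^q\,d\mu+\int_M|\nabla F|^q\,d\mu\right)^{1/q}$. Let $(M,\mathcal L,g,F,\lambda)$ be an EYM system with $|\lambda|\le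 1$ and $\mathrm{Vol}(M)\le V$, and let $1<p<\infty$. Then $|F|^2$ is constant on $M$, and $$\left(\int_M|\nabla F|^{2p}\,d\mu\right)^{1/p}\le 2\max\{1,2V^{1/p}\}\,|F|^2\left(1+\left(\int_M|\mathrm{Rm}|^p\,d\mu\right)^{1/p}\right).$$ Moreover, there is a constant $C=C(p,V,|F|^2)>0$, depending only on $p$, $V$ and the value of $|F|^2$ (not on $n$, nor on the system), such that $$\|F\|_{W^{1,2p}}^2\le C\left(1+\|\mathrm{Rm}\|_{L^p}\right).$$ -/

import Mathlib

open MeasureTheory Bundle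
open scoped Manifold ContDiff

noncomputable section

namespace EYM

/-- The model space `ℝⁿ`, with its Euclidean structure. -/
abbrev Euc (n : ℕ) : Type := EuclideanSpace ℝ (Fin n)

/-! ### Riemannian geometry in coordinates

`G` is a field of matrices `g_ij` on (an open part of) `ℝⁿ`, and `Ω` a field of covariant
2-tensors `F_ij`. -/

section Coordinates

variable {n : ℕ}

/-- The coordinate derivative `∂_i f` at `y`. -/
def pd (i : Fin n) (f : Euc n → ℝ) (y : Euc n) : ℝ :=
  fderiv ℝ f y (EuclideanSpace.single i 1)

/-- The Christoffel symbol `Γ^k_ij = ½ g^{kl} (∂_i g_jl + ∂_j g_il - ∂_l g_ij)`. -/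
def christoffel (G : Euc n → Matrix (Fin n) (Fin n) ℝ) (k i j : Fin n) (y : Euc n) : ℝ :=
  (1 / 2) * ∑ l, (G y)⁻¹ k l *
    (pd i (fun z => G z j l) y + pd j (fun z => G z i l) y - pd l (fun z => G z i j) y)

/-- The components `R^l_{ijk}` of the Riemann curvature tensor of the Levi-Civita connection,
`∇_i ∇_j ∂_k - ∇_j ∇_i ∂_k = R^l_{ijk} ∂_l`. -/
def riemann (G : Euc n → Matrix (Fin n) (Fin n) ℝ) (l i j k : Fin n) (y : Euc n) : ℝ :=
  pd i (christoffel G l j k) y - pd j (christoffel G l i k) y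
    + ∑ m, (christoffel G l i m y * christoffel G m j k y
        - christoffel G l j m y * christoffel G m i k y)

/-- The fully covariant curvature tensor `R_{ijkl} = g_{lm} R^m_{ijk}`. -/
def riemannLow (G : Euc n → Matrix (Fin n) (Fin n) ℝ) (i j k l : Fin n) (y : Euc n) : ℝ :=
  ∑ m, G y l m * riemann G m i j k y

/-- The Ricci tensor `R_jk = R^i_{ijk}` (positive on round spheres). -/
def ricci (G : Euc n → Matrix (Fin n) (Fin n) ℝ) (j k : Fin n) (y : Euc n) : ℝ :=
  ∑ i, riemann G i i j k y

/-- The covariant derivative `∇_k F_ij = ∂_k F_ij - Γ^m_ki F_mj - Γ^m_kj F_im`. -/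
def nabla (G Ω : Euc n → Matrix (Fin n) (Fin n) ℝ) (k i j : Fin n) (y : Euc n) : ℝ :=
  pd k (fun z => Ω z i j) y
    - ∑ m, (christoffel G m k i y * Ω y m j + christoffel G m k j y * Ω y i m)

/-- The codifferential of a 2-form, `(d^* F)_j = - g^{ki} ∇_k F_ij`. -/
def codiff (G Ω : Euc n → Matrix (Fin n) (Fin n) ℝ) (j : Fin n) (y : Euc n) : ℝ :=
  - ∑ k, ∑ i, (G y)⁻¹ k i * nabla G Ω k i j y

/-- The tensor `η_ij = g^{kl} F_ik F_jl`. -/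
def eta (G Ω : Euc n → Matrix (Fin n) (Fin n) ℝ) (i j : Fin n) (y : Euc n) : ℝ :=
  ∑ k, ∑ l, (G y)⁻¹ k l * Ω y i k * Ω y j l

/-- The squared norm `g^{i₁j₁} ⋯ g^{i_kj_k} T_{i₁…i_k} T_{j₁…j_k}` of a covariant `k`-tensor;
`H` is the inverse matrix `(g^{ij})`. -/
def tensorNormSq (H : Matrix (Fin n) (Fin n) ℝ) {k : ℕ} (T : (Fin k → Fin n) → ℝ) : ℝ :=
  ∑ I : Fin k → Fin n, ∑ J : Fin k → Fin n, (∏ a, H (I a) (J a)) * T I * T J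

end Coordinates

/-! ### Riemannian metrics, forms and the volume on a manifold -/

section Manifold

variable {n : ℕ} {M : Type*} [TopologicalSpace M] [ChartedSpace (Euc n) M]

/-- A field of bilinear forms on the tangent spaces. -/
abbrev TwoForm (n : ℕ) (M : Type*) [TopologicalSpace M] [ChartedSpace (Euc n) M] : Type _ :=
  ∀ x : M, TangentSpace (𝓡 n) x →L[ℝ] TangentSpace (𝓡 n) x →L[ℝ] ℝ

/-- A field of linear forms on the tangent spaces. -/
abbrev OneForm (n : ℕ) (M : Type*) [TopologicalSpace M] [ChartedSpace (Euc n) M] : Type _ :=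
  ∀ x : M, TangentSpace (𝓡 n) x →L[ℝ] ℝ

/-- The coordinate vector `∂_i` of the chart `e`, at the point with coordinates `y`. -/
def coordVec (e : OpenPartialHomeomorph M (Euc n)) (y : Euc n) (i : Fin n) :
    TangentSpace (𝓡 n) (e.symm y) :=
  mfderiv 𝓘(ℝ, Euc n) (𝓡 n) e.symm y (EuclideanSpace.single i (1 : ℝ) : Euc n)

/-- The components `F_ij = F(∂_i, ∂_j)` in the chart `e`. -/
def coordForm (F : TwoForm n M) (e : OpenPartialHomeomorph M (Euc n)) (y : Euc n) :
    Matrix (Fin n) (Fin n) ℝ :=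
  Matrix.of fun i j => F (e.symm y) (coordVec e y i) (coordVec e y j)

variable [IsManifold (𝓡 n) ∞ M]

/-- Smooth Riemannian metrics. -/
abbrev Metric (n : ℕ) (M : Type*) [TopologicalSpace M] [ChartedSpace (Euc n) M]
    [IsManifold (𝓡 n) ∞ M] : Type _ :=
  ContMDiffRiemannianMetric (𝓡 n) ∞ (Euc n) (fun x : M => TangentSpace (𝓡 n) x)

/-- The components `g_ij = g(∂_i, ∂_j)` in the chart `e`. -/
def coordMetric (g : Metric n M) (e : OpenPartialHomeomorph M (Euc n)) :
    Euc n → Matrix (Fin n) (Fin n) ℝ :=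
  coordForm g.inner e

/-- `|F|²` at `x`, the norm being that of covariant 2-tensors: `|F|² = F_ij F^ij`. -/
def formNormSq (g : Metric n M) (F : TwoForm n M) (x : M) : ℝ :=
  let e := chartAt (Euc n) x
  tensorNormSq (coordMetric g e (e x))⁻¹
    (fun I : Fin 2 → Fin n => coordForm F e (e x) (I 0) (I 1))

/-- `|∇F|²` at `x`: `|∇F|² = ∇_k F_ij ∇^k F^ij`, with `∇` the Levi-Civita connection. -/
def nablaNormSq (g : Metric n M) (F : TwoForm n M) (x : M) : ℝ :=
  let e := chartAt (Euc n) x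
  tensorNormSq (coordMetric g e (e x))⁻¹
    (fun I : Fin 3 → Fin n => nabla (coordMetric g e) (coordForm F e) (I 0) (I 1) (I 2) (e x))

/-- `|Rm|²` at `x`: `|Rm|² = R_ijkl R^ijkl`. -/
def riemannNormSq (g : Metric n M) (x : M) : ℝ :=
  let e := chartAt (Euc n) x
  tensorNormSq (coordMetric g e (e x))⁻¹
    (fun I : Fin 4 → Fin n => riemannLow (coordMetric g e) (I 0) (I 1) (I 2) (I 3) (e x))

/-- The Riemannian volume: the least measure on `M` that dominates `√(det g_ij) dy` in every
preferred chart. Since these local measures agree on overlaps, on the domain of each of those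
charts it is `√(det g_ij) dy`. -/
def volumeMeasure [MeasurableSpace M] (g : Metric n M) : Measure M :=
  ⨆ x : M, Measure.map (chartAt (Euc n) x).symm
    (((volume : Measure (Euc n)).restrict (chartAt (Euc n) x).target).withDensity
      fun y => ENNReal.ofReal (Real.sqrt (coordMetric g (chartAt (Euc n) x) y).det))

/-- The `L^q` norm `(∫_M u^q dμ)^{1/q}` of the non-negative function `u`, with respect to the
Riemannian volume, as an extended real number. -/
def lpNorm [MeasurableSpace M] (g : Metric n M) (q : ℝ) (u : M → ℝ) : ENNReal :=
  (∫⁻ x, ENNReal.ofReal (u x) ^ q ∂(volumeMeasure g)) ^ (1 / q)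

/-- The Sobolev norm `‖F‖_{W^{1,q}} = (∫_M |F|^q dμ + ∫_M |∇F|^q dμ)^{1/q}`. -/
def sobolevNorm [MeasurableSpace M] (g : Metric n M) (q : ℝ) (F : TwoForm n M) : ENNReal :=
  ((∫⁻ x, ENNReal.ofReal (Real.sqrt (formNormSq g F x)) ^ q ∂(volumeMeasure g))
    + ∫⁻ x, ENNReal.ofReal (Real.sqrt (nablaNormSq g F x)) ^ q ∂(volumeMeasure g)) ^ (1 / q)

end Manifold

/-! ### Principal `U(1)`-bundles, connections, curvature -/

section Bundle

/-- The exterior derivative of a 1-form, `dα(v, w) = ∂_v (α(w)) - ∂_w (α(v))` computed in the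
preferred chart at `p`. -/
def extDerivOneForm {m : ℕ} {P : Type*} [TopologicalSpace P] [ChartedSpace (Euc m) P]
    (α : OneForm m P) (p : P) (v w : TangentSpace (𝓡 m) p) : ℝ :=
  let e := chartAt (Euc m) p
  let a : Euc m → (Euc m →L[ℝ] ℝ) := fun y =>
    (α (e.symm y)).comp (mfderiv 𝓘(ℝ, Euc m) (𝓡 m) e.symm y)
  let v' : Euc m := mfderiv (𝓡 m) 𝓘(ℝ, Euc m) e p v
  let w' : Euc m := mfderiv (𝓡 m) 𝓘(ℝ, Euc m) e p w
  fderiv ℝ a (e p) v' w' - fderiv ℝ a (e p) w' v'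

variable {n : ℕ} {M : Type*} [TopologicalSpace M] [ChartedSpace (Euc n) M]
  {P : Type*} [TopologicalSpace P] [ChartedSpace (Euc (n + 1)) P] [MulAction Circle P]

/-- `pr : P → M` is a smooth principal `U(1)`-bundle: the action of the circle preserves the
fibres, and `P` is locally diffeomorphic to `U × U(1)`, equivariantly and over `U`. -/
structure IsPrincipalCircleBundle (pr : P → M) : Prop where
  proj_smul : ∀ (z : Circle) (p : P), pr (z • p) = pr p
  exists_trivialization : ∀ x : M, ∃ (U : Set M)
    (Φ : PartialDiffeomorph (𝓡 (n + 1)) ((𝓡 n).prod (𝓡 1)) P (M × Circle) ∞),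
    IsOpen U ∧ x ∈ U ∧ Φ.source = pr ⁻¹' U ∧ Φ.target = U ×ˢ Set.univ ∧
    (∀ p ∈ Φ.source, (Φ p).1 = pr p) ∧
    ∀ p ∈ Φ.source, ∀ z : Circle, (Φ (z • p)).2 = z * (Φ p).2

variable [IsManifold (𝓡 (n + 1)) ∞ P]

/-- `A` is the 1-form of a smooth connection on the principal `U(1)`-bundle `P`, the Lie algebra
`iℝ` of `U(1)` being identified with `ℝ`: it is smooth, invariant, and equal to `1` on the
generator of the action. -/
structure IsConnectionForm (A : OneForm (n + 1) P) : Prop where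
  smooth : ContMDiff (𝓡 (n + 1)) ((𝓡 (n + 1)).prod 𝓘(ℝ, Euc (n + 1) →L[ℝ] ℝ)) ∞
    (fun p : P => TotalSpace.mk' (Euc (n + 1) →L[ℝ] ℝ)
      (E := fun p : P => TangentSpace (𝓡 (n + 1)) p →L[ℝ] Bundle.Trivial P ℝ p) p (A p))
  invariant : ∀ (z : Circle) (p : P) (v : TangentSpace (𝓡 (n + 1)) p),
    A (z • p) (mfderiv (𝓡 (n + 1)) (𝓡 (n + 1)) (fun q : P => z • q) p v) = A p v
  generator : ∀ p : P,
    A ((Circle.exp 0) • p)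
      (mfderiv 𝓘(ℝ, ℝ) (𝓡 (n + 1)) (fun t : ℝ => Circle.exp t • p) 0 (1 : ℝ)) = 1

/-- The real 2-form `F` on `M` is the curvature of the connection `A` on `pr : P → M`, that is
`pr^* F = dA`. -/
def IsCurvatureOf (F : TwoForm n M) (pr : P → M) (A : OneForm (n + 1) P) : Prop :=
  ∀ (p : P) (v w : TangentSpace (𝓡 (n + 1)) p),
    F (pr p) (mfderiv (𝓡 (n + 1)) (𝓡 n) pr p v) (mfderiv (𝓡 (n + 1)) (𝓡 n) pr p w)
      = extDerivOneForm A p v w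

/-- `(M, P, g, F, lam)` is an Einstein Yang-Mills system: `F` is the curvature of the connection
`A` on the principal `U(1)`-bundle `pr : P → M`, and, in all smooth local coordinates of `M`,
`R_ij - ½ η_ij = lam g_ij` and `d^* F = 0`. -/
structure IsEYMSystem [IsManifold (𝓡 n) ∞ M] (pr : P → M) (g : Metric n M)
    (A : OneForm (n + 1) P) (F : TwoForm n M) (lam : ℝ) : Prop where
  bundle : IsPrincipalCircleBundle (n := n) pr
  connection : IsConnectionForm (n := n) A
  curvature : IsCurvatureOf F pr A
  einstein : ∀ e ∈ IsManifold.maximalAtlas (𝓡 n) ∞ M, ∀ y ∈ e.target, ∀ i j : Fin n,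
    ricci (coordMetric g e) i j y - (1 / 2) * eta (coordMetric g e) (coordForm F e) i j y
      = lam * coordMetric g e y i j
  yangMills : ∀ e ∈ IsManifold.maximalAtlas (𝓡 n) ∞ M, ∀ y ∈ e.target, ∀ j : Fin n,
    codiff (coordMetric g e) (coordForm F e) j y = 0

end Bundle

end EYM

end

noncomputable section

namespace EYM

/-! ### Levi-Civita calculus over a commutative ring with commuting derivations -/

/-! Everything rests on two pointwise facts. (1) `|F|²` is constant. Since `dF = 0` and `d^*F = 0`,
the divergence of `η` is `¼ ∇|F|²`. Put `Ric = λg + ½η` into the contracted Bianchi identity `2 div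
Ric = ∇R`: the left side is `¼ ∇|F|²` and the right side `½ ∇|F|²`, in every dimension, so both
vanish (`trace_covLow_eq_zero`). (2) Differentiating `|F|² = const` twice gives `⟨∇_l F, ∇_k F⟩ =
-⟨F, ∇_l ∇_k F⟩` with no integration by parts. Take the trace, use `dF = 0` to move the derivative
index, commute derivatives and use `d^*F = 0`; only curvature terms survive, and the Einstein
equation removes Ricci: `|∇F|² = -2 Rm(F,F) - 2λ|F|² - |η|²` (`bochner`). Dropping `-|η|²` and using
Cauchy–Schwarz and `|λ| ≤ 1` gives `|∇F|² ≤ 2|F|²(|Rm| + 1)`, free of `n` (`tensorNormSq_nabla_le`).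
The integral bounds follow from this inequality by Minkowski. The tensor calculus is done with
matrices over an abstract ring with commuting derivations, then specialised to the smooth functions
on a chart domain (`IsLocalEYM.leviCivita`) and evaluated at points. Closedness and smoothness of
`F` come from local potentials, pullbacks of the connection form by sections (`exists_potential`).
-/

/-- A metric `G` with inverse `H` and Levi-Civita connection matrices `(Γ_i)^k_j = Γ^k_ij` over a
commutative ring with commuting derivations. -/
structure LeviCivita (n : ℕ) (R : Type*) [CommRing R] where
  d : Fin n → Derivation ℤ R R
  d_comm : ∀ i j a, d i (d j a) = d j (d i a)
  G : Matrix (Fin n) (Fin n) R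
  H : Matrix (Fin n) (Fin n) R
  Γ : Fin n → Matrix (Fin n) (Fin n) R
  G_symm : G.transpose = G
  G_mul_H : G * H = 1
  torsion_free : ∀ i j k, Γ i k j = Γ j k i
  compat : ∀ k, G.map (d k) = G * Γ k + (Γ k).transpose * G

namespace LeviCivita

open Matrix

variable {n : ℕ} {R : Type*} [CommRing R] (S : LeviCivita n R)

/-- Entrywise derivative of a matrix. -/
def dm (k : Fin n) (X : Matrix (Fin n) (Fin n) R) : Matrix (Fin n) (Fin n) R := X.map (S.d k)

theorem dm_apply (k i j : Fin n) (X : Matrix (Fin n) (Fin n) R) :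
    S.dm k X i j = S.d k (X i j) := rfl

theorem dm_add (k : Fin n) (X Y : Matrix (Fin n) (Fin n) R) :
    S.dm k (X + Y) = S.dm k X + S.dm k Y := by
  ext i j; simp [dm_apply]

theorem dm_sub (k : Fin n) (X Y : Matrix (Fin n) (Fin n) R) :
    S.dm k (X - Y) = S.dm k X - S.dm k Y := by
  ext i j; simp [dm_apply]

theorem dm_neg (k : Fin n) (X : Matrix (Fin n) (Fin n) R) :
    S.dm k (-X) = -S.dm k X := by
  ext i j; simp [dm_apply]

theorem dm_mul (k : Fin n) (X Y : Matrix (Fin n) (Fin n) R) :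
    S.dm k (X * Y) = S.dm k X * Y + X * S.dm k Y := by
  ext i j
  simp only [dm_apply, mul_apply, Matrix.add_apply, map_sum, Derivation.leibniz, smul_eq_mul,
    Finset.sum_add_distrib]
  rw [add_comm]
  congr 1
  exact Finset.sum_congr rfl fun _ _ => mul_comm _ _

theorem dm_one (k : Fin n) : S.dm k 1 = 0 := by
  ext i j
  by_cases h : i = j <;> simp [dm_apply, h]

theorem dm_transpose (k : Fin n) (X : Matrix (Fin n) (Fin n) R) :
    S.dm k Xᵀ = (S.dm k X)ᵀ := rfl

theorem dm_comm (k l : Fin n) (X : Matrix (Fin n) (Fin n) R) :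
    S.dm k (S.dm l X) = S.dm l (S.dm k X) := by
  ext i j; exact S.d_comm k l _

theorem d_trace (k : Fin n) (X : Matrix (Fin n) (Fin n) R) :
    S.d k X.trace = (S.dm k X).trace := by
  simp [Matrix.trace, dm_apply]

theorem dm_G (k : Fin n) : S.dm k S.G = S.G * S.Γ k + (S.Γ k)ᵀ * S.G := S.compat k

theorem H_mul_G : S.H * S.G = 1 := mul_eq_one_comm.1 S.G_mul_H

theorem H_symm : S.Hᵀ = S.H := by
  have h : S.Hᵀ * S.G = 1 := by
    rw [← S.G_symm, ← transpose_mul, S.G_mul_H, transpose_one]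
  calc S.Hᵀ = S.Hᵀ * (S.G * S.H) := by rw [S.G_mul_H, mul_one]
    _ = S.H := by rw [← mul_assoc, h, one_mul]

/-- Differentiate `H * G = 1` and solve. This is `∇H = 0` written out. -/
theorem dm_H (k : Fin n) : S.dm k S.H = -(S.Γ k * S.H) - S.H * (S.Γ k)ᵀ := by
  have h := S.dm_mul k S.H S.G
  rw [S.H_mul_G, dm_one, dm_G] at h
  have h2 : S.dm k S.H * (S.G * S.H) =
      -(S.H * (S.G * S.Γ k + (S.Γ k)ᵀ * S.G)) * S.H := by
    rw [← mul_assoc, eq_neg_of_add_eq_zero_left h.symm]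
  rw [S.G_mul_H, mul_one] at h2
  rw [h2]
  calc _ = -((S.H * S.G) * S.Γ k * S.H) - S.H * (S.Γ k)ᵀ * (S.G * S.H) := by noncomm_ring
    _ = _ := by rw [S.H_mul_G, S.G_mul_H, one_mul, mul_one]

/-- Covariant derivative of a covariant 2-tensor. -/
def covLow (k : Fin n) (X : Matrix (Fin n) (Fin n) R) : Matrix (Fin n) (Fin n) R :=
  S.dm k X - (S.Γ k)ᵀ * X - X * S.Γ k

/-- Covariant derivative of an endomorphism. -/
def covEnd (k : Fin n) (X : Matrix (Fin n) (Fin n) R) : Matrix (Fin n) (Fin n) R :=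
  S.dm k X + S.Γ k * X - X * S.Γ k

/-- The connection enters through a commutator, which has trace zero; scalars written as traces can
thus be differentiated covariantly. -/
theorem d_trace_eq_covEnd (k : Fin n) (X : Matrix (Fin n) (Fin n) R) :
    S.d k X.trace = (S.covEnd k X).trace := by
  rw [d_trace, covEnd, trace_sub, trace_add, trace_mul_comm X]
  ring

theorem covEnd_H_mul (k : Fin n) (X : Matrix (Fin n) (Fin n) R) :
    S.covEnd k (S.H * X) = S.H * S.covLow k X := by
  rw [covEnd, covLow, dm_mul, dm_H]
  noncomm_ring

theorem covEnd_mul (k : Fin n) (X Y : Matrix (Fin n) (Fin n) R) :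
    S.covEnd k (X * Y) = S.covEnd k X * Y + X * S.covEnd k Y := by
  simp only [covEnd, dm_mul]
  noncomm_ring

theorem covLow_mul (k : Fin n) (X Y : Matrix (Fin n) (Fin n) R) :
    S.covLow k (X * Y) = S.covLow k X * Y + X * S.covEnd k Y := by
  simp only [covLow, covEnd, dm_mul]
  noncomm_ring

theorem covLow_G (k : Fin n) : S.covLow k S.G = 0 := by
  rw [covLow, dm_G]; abel

theorem covLow_transpose (k : Fin n) (X : Matrix (Fin n) (Fin n) R) :
    S.covLow k Xᵀ = (S.covLow k X)ᵀ := by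
  simp only [covLow, dm_transpose, transpose_sub, transpose_mul, transpose_transpose]
  abel

/-! ### Curvature, the Ricci tensor and the Bianchi identities -/

/-- The curvature endomorphisms. -/
def curv (i j : Fin n) : Matrix (Fin n) (Fin n) R :=
  S.dm i (S.Γ j) - S.dm j (S.Γ i) + (S.Γ i * S.Γ j - S.Γ j * S.Γ i)

theorem curv_swap (i j : Fin n) : S.curv j i = -S.curv i j := by
  simp only [curv]; abel

/-- Ricci identity. The derivative directions are mere labels here, not tensor slots, so no torsion
term appears. -/
theorem covLow_comm (i j : Fin n) (X : Matrix (Fin n) (Fin n) R) :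
    S.covLow i (S.covLow j X) - S.covLow j (S.covLow i X)
      = -((S.curv i j)ᵀ * X) - X * S.curv i j := by
  simp only [covLow, curv, dm_sub, dm_mul, dm_transpose, transpose_add, transpose_sub,
    transpose_mul, S.dm_comm i j X]
  noncomm_ring

/-- The Ricci identity applied to `G`, whose covariant derivative is zero. -/
theorem curv_skew (i j : Fin n) : (S.curv i j)ᵀ * S.G = -(S.G * S.curv i j) := by
  have h := S.covLow_comm i j S.G
  have h0 : ∀ k, S.covLow k 0 = 0 := fun k => by
    ext a b; simp [covLow, dm_apply]
  rw [covLow_G, covLow_G, h0, h0, sub_zero] at h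
  have h1 : (S.curv i j)ᵀ * S.G = -(-((S.curv i j)ᵀ * S.G) - S.G * S.curv i j)
    - S.G * S.curv i j := by abel
  rw [h1, ← h]; abel

theorem curv_mul_H_skew (i j : Fin n) : (S.curv i j * S.H)ᵀ = -(S.curv i j * S.H) := by
  rw [transpose_mul, H_symm]
  calc S.H * (S.curv i j)ᵀ = S.H * ((S.curv i j)ᵀ * (S.G * S.H)) := by
        rw [S.G_mul_H, mul_one]
    _ = S.H * ((S.curv i j)ᵀ * S.G) * S.H := by noncomm_ring
    _ = -((S.H * S.G) * S.curv i j * S.H) := by rw [curv_skew]; noncomm_ring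
    _ = _ := by rw [S.H_mul_G, one_mul]

/-- Jacobi identity for the operators `∂_i + Γ_i`; torsion-freeness plays no role until `i j k` are
treated as tensor slots. -/
theorem bianchi (i j k : Fin n) :
    S.covEnd i (S.curv j k) + S.covEnd j (S.curv k i) + S.covEnd k (S.curv i j) = 0 := by
  simp only [covEnd, curv, dm_add, dm_sub, dm_mul, S.dm_comm j i, S.dm_comm k i, S.dm_comm k j]
  noncomm_ring

/-- The covariant derivative of the curvature tensor. -/
def covCurv (l i j : Fin n) : Matrix (Fin n) (Fin n) R :=
  S.covEnd l (S.curv i j) - ∑ m, S.Γ l m i • S.curv m j - ∑ m, S.Γ l m j • S.curv i m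

theorem covCurv_swap (l i j : Fin n) : S.covCurv l j i = -S.covCurv l i j := by
  have h : S.covEnd l (S.curv j i) = -S.covEnd l (S.curv i j) := by
    rw [S.curv_swap i j]; simp only [covEnd, dm_neg]; noncomm_ring
  simp only [covCurv, h]
  rw [Finset.sum_congr rfl fun m _ => by rw [S.curv_swap i m],
    Finset.sum_congr (f := fun m => S.Γ l m i • S.curv j m) rfl
      fun m _ => by rw [S.curv_swap m j]]
  simp only [smul_neg, Finset.sum_neg_distrib]
  abel

/-- The Christoffel corrections in the 2-form slots cancel in pairs, by symmetry of `Γ` and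
antisymmetry of the curvature. -/
theorem covCurv_bianchi (i j k : Fin n) :
    S.covCurv i j k + S.covCurv j k i + S.covCurv k i j = 0 := by
  have h := S.bianchi i j k
  have e : ∀ a b c, ∑ m, S.Γ a m b • S.curv c m = -∑ m, S.Γ b m a • S.curv m c := by
    intro a b c
    rw [← Finset.sum_neg_distrib]
    refine Finset.sum_congr rfl fun m _ => ?_
    rw [S.curv_swap m c, S.torsion_free a b m, smul_neg]
  simp only [covCurv, e]
  rw [← h]; abel

/-- The Ricci tensor. -/
def ric : Matrix (Fin n) (Fin n) R := Matrix.of fun j k => ∑ i, S.curv i j i k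

theorem ric_apply (j k : Fin n) : S.ric j k = ∑ i, S.curv i j i k := rfl

/-- Contraction commutes with `∇`: the corrections of the contracted upper and lower slots cancel.
-/
theorem covLow_ric (l j k : Fin n) : S.covLow l S.ric j k = ∑ i, S.covCurv l i j i k := by
  simp only [covLow, covCurv, covEnd, Matrix.sub_apply, Matrix.add_apply, dm_apply, mul_apply,
    ric_apply, transpose_apply, Matrix.sum_apply, Matrix.smul_apply, smul_eq_mul, map_sum, Finset.sum_sub_distrib,
    Finset.sum_add_distrib, Finset.mul_sum, Finset.sum_mul]
  rw [Finset.sum_comm (f := fun i m => S.Γ l m i * S.curv m j i k),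
    Finset.sum_comm (f := fun i m => S.Γ l m j * S.curv i m i k),
    Finset.sum_comm (f := fun x i => S.curv i j i x * S.Γ l x k)]
  ring

/-- As `∇H = 0`, covariant differentiation preserves the skewness in `curv_mul_H_skew`. -/
theorem covCurv_mul_H_skew (l i j : Fin n) :
    (S.covCurv l i j * S.H)ᵀ = -(S.covCurv l i j * S.H) := by
  have hD : S.covEnd l (S.curv i j) * S.H = S.dm l (S.curv i j * S.H)
      + S.Γ l * (S.curv i j * S.H) + (S.curv i j * S.H) * (S.Γ l)ᵀ := by
    rw [covEnd, dm_mul, dm_H]; noncomm_ring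
  simp only [covCurv, sub_mul, Finset.sum_mul, smul_mul, transpose_sub, transpose_sum,
    transpose_smul, S.curv_mul_H_skew, hD, transpose_add, ← dm_transpose, transpose_mul (S.Γ l),
    transpose_mul _ (S.Γ l)ᵀ, transpose_transpose]
  simp only [dm_neg, smul_neg, Finset.sum_neg_distrib]
  noncomm_ring

/-- The contracted second Bianchi identity. -/
theorem contracted_bianchi (j : Fin n) :
    ∑ k, ∑ l, S.H k l * S.covLow k S.ric j l + ∑ k, ∑ l, S.H k l * S.covLow k S.ric j l
      = (S.H * S.covLow j S.ric).trace := by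
  -- First trace of the second Bianchi identity; contracting the result with `H` will be the second.
  have h1 : ∀ k l, ∑ i, S.covCurv i j k i l = S.covLow j S.ric k l - S.covLow k S.ric j l := by
    intro k l
    have h : ∑ i, (S.covCurv i j k i l + S.covCurv j k i i l + S.covCurv k i j i l) = 0 := by
      refine Finset.sum_eq_zero fun i _ => ?_
      have := congrFun (congrFun (S.covCurv_bianchi i j k) i) l
      simpa using this
    have hs : ∑ i, S.covCurv j k i i l = -S.covLow j S.ric k l := by
      rw [covLow_ric, ← Finset.sum_neg_distrib]
      refine Finset.sum_congr rfl fun i _ => ?_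
      rw [S.covCurv_swap j i k]; rfl
    rw [Finset.sum_add_distrib, Finset.sum_add_distrib, ← covLow_ric, hs] at h
    linear_combination h
  -- Skewness in the endomorphism slots moves the trace onto the pair that defines `ric`.
  have h2 : ∀ i k, ∑ l, S.covCurv i j k i l * S.H l k = -∑ l, S.covCurv i j k k l * S.H l i := by
    intro i k
    have := congrFun (congrFun (S.covCurv_mul_H_skew i j k) k) i
    simpa [mul_apply] using this
  have h3 : ∀ i l, ∑ k, S.covCurv i j k k l = -S.covLow i S.ric j l := by
    intro i l
    rw [covLow_ric, ← Finset.sum_neg_distrib]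
    refine Finset.sum_congr rfl fun k _ => ?_
    rw [S.covCurv_swap i k j]; rfl
  have hH : ∀ a b, S.H a b = S.H b a := fun a b => congrFun (congrFun S.H_symm b) a
  have h4 : ∑ k, ∑ l, (S.covLow j S.ric k l - S.covLow k S.ric j l) * S.H l k
      = ∑ i, ∑ l, S.covLow i S.ric j l * S.H l i := by
    calc _ = ∑ k, ∑ l, ∑ i, S.covCurv i j k i l * S.H l k := by
          simp only [← h1, Finset.sum_mul]
      _ = ∑ i, ∑ k, ∑ l, S.covCurv i j k i l * S.H l k := by
          rw [Finset.sum_congr rfl fun k _ => Finset.sum_comm, Finset.sum_comm]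
      _ = ∑ i, ∑ l, -(∑ k, S.covCurv i j k k l) * S.H l i := by
          refine Finset.sum_congr rfl fun i _ => ?_
          rw [Finset.sum_congr rfl fun k _ => h2 i k, Finset.sum_neg_distrib, Finset.sum_comm,
            ← Finset.sum_neg_distrib]
          refine Finset.sum_congr rfl fun l _ => ?_
          rw [neg_mul, Finset.sum_mul]
      _ = _ := by simp only [h3, neg_neg]
  simp only [sub_mul, Finset.sum_sub_distrib] at h4
  simp only [Matrix.trace, diag_apply, mul_apply]
  have h5 : ∑ k, ∑ l, S.H k l * S.covLow k S.ric j l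
      = ∑ i, ∑ l, S.covLow i S.ric j l * S.H l i := by
    refine Finset.sum_congr rfl fun k _ => Finset.sum_congr rfl fun l _ => ?_
    rw [hH, mul_comm]
  have h6 : ∑ k, ∑ l, S.H k l * S.covLow j S.ric l k
      = ∑ k, ∑ l, S.covLow j S.ric k l * S.H l k := by
    rw [Finset.sum_comm]
    refine Finset.sum_congr rfl fun k _ => Finset.sum_congr rfl fun l _ => ?_
    rw [mul_comm]
  rw [h5, h6]
  linear_combination -h4

end LeviCivita
-- Harmonic 2-forms: constancy of the norm and the Bochner formula
namespace LeviCivita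

open Matrix

variable {n : ℕ} {R : Type*} [CommRing R] (S : LeviCivita n R)

/-- `Ω` is a closed and coclosed 2-form. -/
structure IsHarmonicForm (Ω : Matrix (Fin n) (Fin n) R) : Prop where
  alt : Ωᵀ = -Ω
  closed : ∀ k i j, S.d k (Ω i j) + S.d i (Ω j k) + S.d j (Ω k i) = 0
  coclosed : ∀ j, ∑ k, ∑ i, S.H k i * S.covLow k Ω i j = 0

/-- The second covariant derivative of a covariant 2-tensor. -/
def covLow₂ (l k : Fin n) (X : Matrix (Fin n) (Fin n) R) : Matrix (Fin n) (Fin n) R :=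
  S.covLow l (S.covLow k X) - ∑ m, S.Γ l m k • S.covLow m X

theorem covLow₂_apply (l k i j : Fin n) (X : Matrix (Fin n) (Fin n) R) :
    S.covLow₂ l k X i j = S.d l (S.covLow k X i j) - ∑ m, S.Γ l m k * S.covLow m X i j
      - ∑ m, S.Γ l m i * S.covLow k X m j - ∑ m, S.Γ l m j * S.covLow k X i m := by
  rw [covLow₂, covLow]
  simp only [Matrix.sub_apply, dm_apply, mul_apply, transpose_apply, Matrix.sum_apply,
    Matrix.smul_apply, smul_eq_mul, mul_comm _ (S.Γ l _ j)]
  ring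

/-- The corrections for the derivative slot are symmetric in `l, k`, so only curvature remains. -/
theorem covLow₂_comm (l k : Fin n) (X : Matrix (Fin n) (Fin n) R) :
    S.covLow₂ l k X = S.covLow₂ k l X - ((S.curv l k)ᵀ * X + X * S.curv l k) := by
  have h := S.covLow_comm l k X
  have h2 : ∑ m, S.Γ l m k • S.covLow m X = ∑ m, S.Γ k m l • S.covLow m X :=
    Finset.sum_congr rfl fun m _ => by rw [S.torsion_free l k m]
  rw [covLow₂, covLow₂, h2, eq_add_of_sub_eq h]
  abel

namespace IsHarmonicForm

variable {S} {Ω : Matrix (Fin n) (Fin n) R} (hΩ : S.IsHarmonicForm Ω)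
include hΩ

theorem covLow_alt (k : Fin n) : (S.covLow k Ω)ᵀ = -S.covLow k Ω := by
  rw [← covLow_transpose, hΩ.alt]
  simp only [covLow, dm_neg]
  noncomm_ring

theorem covLow_swap (k i j : Fin n) : S.covLow k Ω j i = -S.covLow k Ω i j :=
  congrFun (congrFun (hΩ.covLow_alt k) i) j

theorem swap (i j : Fin n) : Ω j i = -Ω i j :=
  congrFun (congrFun hΩ.alt i) j

/-- `dF = 0` with `∂` replaced by `∇`: the Christoffel terms cancel because `Γ` is symmetric and `Ω`
skew. -/
theorem covLow_cyclic (k i j : Fin n) :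
    S.covLow k Ω i j + S.covLow i Ω j k + S.covLow j Ω k i = 0 := by
  have h := hΩ.closed k i j
  have e : ∀ a b c, ∑ m, Ω c m * S.Γ a m b = -∑ m, S.Γ b m a * Ω m c := by
    intro a b c
    rw [← Finset.sum_neg_distrib]
    refine Finset.sum_congr rfl fun m _ => ?_
    rw [hΩ.swap m c, S.torsion_free a b m]; ring
  simp only [covLow, Matrix.sub_apply, dm_apply, mul_apply, transpose_apply, e]
  linear_combination h

theorem covLow₂_swap (l k i j : Fin n) : S.covLow₂ l k Ω j i = -S.covLow₂ l k Ω i j := by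
  simp only [covLow₂_apply, hΩ.covLow_swap _ i j, fun m => hΩ.covLow_swap k i m,
    fun m => hΩ.covLow_swap k m j, map_neg, mul_neg, Finset.sum_neg_distrib]
  ring

/-- The derivative of `covLow_cyclic`; the corrections group into three families, each again a
cyclic sum. -/
theorem covLow₂_cyclic (l k i j : Fin n) :
    S.covLow₂ l k Ω i j + S.covLow₂ l i Ω j k + S.covLow₂ l j Ω k i = 0 := by
  have h : S.d l (S.covLow k Ω i j) + S.d l (S.covLow i Ω j k) + S.d l (S.covLow j Ω k i) = 0 := by
    rw [← map_add, ← map_add, hΩ.covLow_cyclic, map_zero]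
  have e : ∀ a b c, ∑ m, S.Γ l m a * S.covLow m Ω b c + ∑ m, S.Γ l m a * S.covLow b Ω c m
      + ∑ m, S.Γ l m a * S.covLow c Ω m b = 0 := by
    intro a b c
    rw [← Finset.sum_add_distrib, ← Finset.sum_add_distrib]
    refine Finset.sum_eq_zero fun m _ => ?_
    rw [← mul_add, ← mul_add, hΩ.covLow_cyclic, mul_zero]
  simp only [covLow₂_apply]
  linear_combination h - e k i j - e i j k - e j k i

/-- The derivative of `d^*Ω = 0`. The terms from `dm_H` account for the corrections of the
contracted slots, and the correction of the free slot is a multiple of `d^*Ω`. -/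
theorem covLow₂_coclosed (l j : Fin n) : ∑ k, ∑ i, S.H k i * S.covLow₂ l k Ω i j = 0 := by
  have h : S.d l (∑ k, ∑ i, S.H k i * S.covLow k Ω i j) = 0 := by
    rw [hΩ.coclosed, map_zero]
  have hd : ∀ k i, S.d l (S.H k i) = -(∑ m, S.Γ l k m * S.H m i) - ∑ m, S.H k m * S.Γ l i m := by
    intro k i
    have := congrFun (congrFun (S.dm_H l) k) i
    simpa [dm_apply, mul_apply] using this
  simp only [map_sum, Derivation.leibniz, smul_eq_mul, hd, Finset.sum_add_distrib, mul_sub,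
    mul_neg, Finset.sum_sub_distrib, Finset.sum_neg_distrib, Finset.mul_sum] at h
  have e1 : ∑ k, ∑ i, ∑ m, S.covLow k Ω i j * (S.Γ l k m * S.H m i)
      = ∑ k, ∑ i, ∑ m, S.H k i * (S.Γ l m k * S.covLow m Ω i j) := by
    rw [Finset.sum_congr rfl fun k _ => Finset.sum_comm, Finset.sum_comm]
    refine Finset.sum_congr rfl fun k _ => ?_
    rw [Finset.sum_comm]
    exact Finset.sum_congr rfl fun i _ => Finset.sum_congr rfl fun m _ => by ring
  have e2 : ∑ k, ∑ i, ∑ m, S.covLow k Ω i j * (S.H k m * S.Γ l i m)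
      = ∑ k, ∑ i, ∑ m, S.H k i * (S.Γ l m i * S.covLow k Ω m j) := by
    refine Finset.sum_congr rfl fun k _ => ?_
    rw [Finset.sum_comm]
    exact Finset.sum_congr rfl fun i _ => Finset.sum_congr rfl fun m _ => by ring
  have e3 : ∑ k, ∑ i, ∑ m, S.H k i * (S.Γ l m j * S.covLow k Ω i m) = 0 := by
    rw [Finset.sum_congr rfl fun k _ => Finset.sum_comm, Finset.sum_comm]
    refine Finset.sum_eq_zero fun m _ => ?_
    rw [← mul_zero (S.Γ l m j), ← hΩ.coclosed m, Finset.mul_sum]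
    refine Finset.sum_congr rfl fun k _ => ?_
    rw [Finset.mul_sum]
    exact Finset.sum_congr rfl fun i _ => by ring
  simp only [covLow₂_apply, mul_sub, Finset.sum_sub_distrib, Finset.mul_sum]
  rw [e1, e2] at h
  rw [e3]
  linear_combination h

theorem raised_alt : (S.H * Ω * S.H)ᵀ = -(S.H * Ω * S.H) := by
  rw [transpose_mul, transpose_mul, H_symm, hΩ.alt]; noncomm_ring

omit hΩ in
theorem d_trace_sq (k : Fin n) :
    S.d k (S.H * Ω * (S.H * Ω)).trace = 2 * (S.H * S.covLow k Ω * (S.H * Ω)).trace := by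
  rw [d_trace_eq_covEnd, covEnd_mul, covEnd_H_mul, trace_add, trace_mul_comm (S.H * Ω)]
  ring

variable {c : R} (hc : ∀ k, S.d k c = 0)
  (hE : S.ric + S.ric = (c + c) • S.G + Ω * S.H * Ωᵀ)
include hc hE

/-- The `λg` part of the Einstein equation is parallel; the signs come from `Ωᵀ = -Ω`. -/
theorem covLow_ric_add (k : Fin n) : S.covLow k S.ric + S.covLow k S.ric
    = -(S.covLow k Ω * (S.H * Ω)) - Ω * (S.H * S.covLow k Ω) := by
  have h : S.covLow k (S.ric + S.ric) = S.covLow k S.ric + S.covLow k S.ric := by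
    simp only [covLow, dm_add]; noncomm_ring
  have hG : S.covLow k ((c + c) • S.G) = (c + c) • S.covLow k S.G := by
    have : S.dm k ((c + c) • S.G) = (c + c) • S.dm k S.G := by
      ext i j; simp [dm_apply, hc]
    simp only [covLow, this, Matrix.mul_smul, smul_mul, smul_sub]
  have hN : S.covLow k (-(Ω * (S.H * Ω))) = -S.covLow k (Ω * (S.H * Ω)) := by
    simp only [covLow, dm_neg]; noncomm_ring
  have ha : S.covLow k ((c + c) • S.G + -(Ω * (S.H * Ω)))
      = S.covLow k ((c + c) • S.G) + S.covLow k (-(Ω * (S.H * Ω))) := by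
    simp only [covLow, dm_add]; noncomm_ring
  rw [← h, hE, hΩ.alt, mul_neg, mul_assoc, ha, hG, covLow_G, smul_zero, zero_add, hN, covLow_mul,
    covEnd_H_mul]
  noncomm_ring

/-- Let `t` be this trace and `X = ∇_k Ω_ja (HΩH)^ak`. Contracted Bianchi with the Einstein equation
gives `2X = 2t`, while closedness and skewness give `2X = t`. Subtracting yields `t = 0` without
dividing by 2. -/
theorem trace_covLow_eq_zero (j : Fin n) : (S.H * S.covLow j Ω * (S.H * Ω)).trace = 0 := by
  have hcb := S.contracted_bianchi j
  have h2 : (∑ k, ∑ l, S.H k l * (S.covLow k S.ric + S.covLow k S.ric) j l) * 2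
      = (S.H * (S.covLow j S.ric + S.covLow j S.ric)).trace := by
    simp only [Matrix.add_apply, mul_add, Finset.sum_add_distrib, trace_add]
    linear_combination 2 * hcb
  -- In the divergence of `η`, the term where the derivative meets its contracted index is a
  -- multiple of `d^*Ω`.
  have h3 : ∑ k, ∑ l, S.H k l * (Ω * (S.H * S.covLow k Ω)) j l = 0 := by
    simp only [← mul_assoc, mul_apply (M := Ω * S.H), Finset.mul_sum]
    rw [Finset.sum_congr rfl fun k _ => Finset.sum_comm, Finset.sum_comm]
    refine Finset.sum_eq_zero fun a _ => ?_
    rw [← mul_zero (-((Ω * S.H) j a)), ← hΩ.coclosed a, Finset.mul_sum]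
    refine Finset.sum_congr rfl fun k _ => ?_
    rw [Finset.mul_sum]
    refine Finset.sum_congr rfl fun l _ => ?_
    rw [hΩ.covLow_swap k l a]; ring
  have h4 : ∑ k, ∑ l, S.H k l * (S.covLow k Ω * (S.H * Ω)) j l
      = ∑ k, ∑ a, S.covLow k Ω j a * (S.H * Ω * S.H) a k := by
    refine Finset.sum_congr rfl fun k _ => ?_
    have hH : ∀ l, S.H k l = S.H l k := fun l => congrFun (congrFun S.H_symm l) k
    calc _ = ∑ l, (S.covLow k Ω * (S.H * Ω)) j l * S.H l k :=
          Finset.sum_congr rfl fun l _ => by rw [hH, mul_comm]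
      _ = (S.covLow k Ω * (S.H * Ω) * S.H) j k := (mul_apply ..).symm
      _ = _ := by rw [mul_assoc, mul_apply]
  have hZ : ∀ a k, (S.H * Ω * S.H) k a = -(S.H * Ω * S.H) a k := fun a k =>
    congrFun (congrFun hΩ.raised_alt a) k
  have h5 : ∑ k, ∑ a, S.covLow k Ω j a * (S.H * Ω * S.H) a k
      = -∑ k, ∑ a, S.covLow a Ω j k * (S.H * Ω * S.H) a k := by
    rw [Finset.sum_comm, ← Finset.sum_neg_distrib]
    refine Finset.sum_congr rfl fun k _ => ?_
    rw [← Finset.sum_neg_distrib]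
    refine Finset.sum_congr rfl fun a _ => ?_
    rw [hZ a k]; ring
  have h6 : (S.H * S.covLow j Ω * (S.H * Ω)).trace
      = ∑ k, ∑ a, S.covLow j Ω k a * (S.H * Ω * S.H) a k := by
    rw [mul_assoc, trace_mul_comm, mul_assoc]
    simp only [Matrix.trace, diag_apply]
    exact Finset.sum_congr rfl fun k _ => mul_apply ..
  have h7 : ∑ k, ∑ a, S.covLow k Ω j a * (S.H * Ω * S.H) a k
      - ∑ k, ∑ a, S.covLow a Ω j k * (S.H * Ω * S.H) a k
      = (S.H * S.covLow j Ω * (S.H * Ω)).trace := by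
    rw [h6, ← Finset.sum_sub_distrib]
    refine Finset.sum_congr rfl fun k _ => ?_
    rw [← Finset.sum_sub_distrib]
    refine Finset.sum_congr rfl fun a _ => ?_
    have := hΩ.covLow_cyclic j a k
    rw [hΩ.covLow_swap j k a, hΩ.covLow_swap a j k] at this
    linear_combination (S.H * Ω * S.H) a k * this
  rw [hΩ.covLow_ric_add hc hE] at h2
  simp only [hΩ.covLow_ric_add hc hE, Matrix.sub_apply, Matrix.neg_apply, mul_sub, mul_neg,
    Finset.sum_sub_distrib, Finset.sum_neg_distrib, h3, h4, trace_sub, trace_neg] at h2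
  have h8 : (S.H * (S.covLow j Ω * (S.H * Ω))).trace
      = (S.H * S.covLow j Ω * (S.H * Ω)).trace := by rw [mul_assoc S.H]
  have h9 : (S.H * (Ω * (S.H * S.covLow j Ω))).trace
      = (S.H * S.covLow j Ω * (S.H * Ω)).trace := by rw [← mul_assoc, trace_mul_comm]
  rw [h8, h9] at h2
  linear_combination h2 + h7 + h5

theorem d_trace_sq_eq_zero (j : Fin n) : S.d j (S.H * Ω * (S.H * Ω)).trace = 0 := by
  rw [d_trace_sq, hΩ.trace_covLow_eq_zero hc hE, mul_zero]

/-- Differentiate `∇_k|F|² = 0` once more. The sign of `⟨∇F, ∇F⟩ = -⟨F, ∇∇F⟩` is absorbed by the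
missing transpose on the right. -/
theorem trace_covLow_mul_covLow (l k : Fin n) :
    (S.H * S.covLow l Ω * (S.H * (S.covLow k Ω)ᵀ)).trace
      = (S.H * Ω * (S.H * S.covLow₂ l k Ω)).trace := by
  have h : S.d l (S.H * S.covLow k Ω * (S.H * Ω)).trace = 0 := by
    rw [hΩ.trace_covLow_eq_zero hc hE, map_zero]
  rw [d_trace_eq_covEnd, covEnd_mul, covEnd_H_mul, covEnd_H_mul, trace_add] at h
  have h2 : (S.H * Ω * (S.H * ∑ m, S.Γ l m k • S.covLow m Ω)).trace = 0 := by
    simp only [Finset.mul_sum, trace_sum, Matrix.mul_smul, trace_smul]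
    refine Finset.sum_eq_zero fun m _ => ?_
    rw [trace_mul_comm, hΩ.trace_covLow_eq_zero hc hE, smul_zero]
  rw [covLow₂, mul_sub, mul_sub, trace_sub, h2, hΩ.covLow_alt, mul_neg, mul_neg, trace_neg,
    trace_mul_comm, trace_mul_comm (S.H * Ω)]
  linear_combination -h

/-- The Bochner formula for `|∇F|²`, when `|F|²` is constant. -/
theorem bochner : ∑ l, ∑ k, S.H l k * (S.H * S.covLow l Ω * (S.H * (S.covLow k Ω)ᵀ)).trace
    = -2 * (∑ l, ∑ a, ∑ b, ∑ d, (S.G * S.curv l a) d b *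
          ((S.H * Ω * S.H) a b * (S.H * Ω * S.H) d l))
      + 2 * c * (S.H * Ω * (S.H * Ω)).trace
      - (S.H * Ω * (S.H * Ω) * (S.H * Ω * (S.H * Ω))).trace := by
  set Z := S.H * Ω * S.H with hZdef
  have hZ : ∀ a k, Z k a = -Z a k := fun a k => congrFun (congrFun hΩ.raised_alt a) k
  -- Closedness trades `∇_l ∇_k Ω_ba` for two terms with `a` or `b` as derivative index; they agree
  -- after pairing with the skew `Z`, hence the factor 2.
  have h1 : ∀ l k, (S.H * S.covLow l Ω * (S.H * (S.covLow k Ω)ᵀ)).trace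
      = 2 * ∑ a, ∑ b, Z a b * S.covLow₂ l a Ω b k := by
    intro l k
    rw [hΩ.trace_covLow_mul_covLow hc hE, ← mul_assoc]
    have : (Z * S.covLow₂ l k Ω).trace = ∑ a, ∑ b, Z a b * S.covLow₂ l k Ω b a := by
      simp only [Matrix.trace, diag_apply, mul_apply]
    rw [this]
    have e : ∑ a, ∑ b, Z a b * S.covLow₂ l b Ω a k = -∑ a, ∑ b, Z a b * S.covLow₂ l a Ω b k := by
      rw [Finset.sum_comm, ← Finset.sum_neg_distrib]
      refine Finset.sum_congr rfl fun k _ => ?_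
      rw [← Finset.sum_neg_distrib]
      refine Finset.sum_congr rfl fun a _ => ?_
      rw [hZ k a]; ring
    have e2 : ∑ a, ∑ b, Z a b * S.covLow₂ l k Ω b a = ∑ a, ∑ b, Z a b * S.covLow₂ l a Ω b k
        - ∑ a, ∑ b, Z a b * S.covLow₂ l b Ω a k := by
      rw [← Finset.sum_sub_distrib]
      refine Finset.sum_congr rfl fun a _ => ?_
      rw [← Finset.sum_sub_distrib]
      refine Finset.sum_congr rfl fun b _ => ?_
      have := hΩ.covLow₂_cyclic l k b a
      rw [hΩ.covLow₂_swap l a b k] at this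
      linear_combination Z a b * this
    rw [e2, e]; ring
  -- After commuting `l` and `a` the main term is a derivative of `d^*Ω`, hence zero; the commutator
  -- leaves one Riemann and one Ricci term.
  have h2 : ∀ a b, ∑ l, ∑ k, S.H l k * S.covLow₂ l a Ω b k
      = -∑ l, ((S.G * S.curv l a)ᵀ * Z) b l + (Ω * S.H * S.ricᵀ) b a := by
    intro a b
    have hH : ∀ l k, S.H l k = S.H k l := fun l k => congrFun (congrFun S.H_symm k) l
    have e0 : ∑ l, ∑ k, S.H l k * S.covLow₂ a l Ω b k = 0 := by
      rw [← neg_zero, ← hΩ.covLow₂_coclosed a b, ← Finset.sum_neg_distrib]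
      refine Finset.sum_congr rfl fun k _ => ?_
      rw [← Finset.sum_neg_distrib]
      refine Finset.sum_congr rfl fun a _ => ?_
      rw [hΩ.covLow₂_swap _ _ b]; ring
    have e1 : ∀ l, ∑ k, S.H l k * ((S.curv l a)ᵀ * Ω) b k = ((S.G * S.curv l a)ᵀ * Z) b l := by
      intro l
      have : (S.G * S.curv l a)ᵀ * Z = (S.curv l a)ᵀ * Ω * S.H := by
        rw [transpose_mul, S.G_symm, hZdef]
        calc _ = (S.curv l a)ᵀ * (S.G * S.H) * Ω * S.H := by noncomm_ring
          _ = _ := by rw [S.G_mul_H, mul_one]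
      rw [this, mul_apply (N := S.H)]
      exact Finset.sum_congr rfl fun k _ => by rw [hH, mul_comm]
    have e2 : ∑ l, ∑ k, S.H l k * (Ω * S.curv l a) b k = -(Ω * S.H * S.ricᵀ) b a := by
      calc _ = ∑ l, (Ω * (S.curv l a * S.H)) b l := by
            refine Finset.sum_congr rfl fun l _ => ?_
            rw [← mul_assoc, mul_apply (N := S.H)]
            exact Finset.sum_congr rfl fun k _ => by rw [hH, mul_comm]
        _ = ∑ l, ∑ x, -(Ω b x * (S.curv l a * S.H) l x) := by
            refine Finset.sum_congr rfl fun l _ => ?_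
            rw [mul_apply]
            refine Finset.sum_congr rfl fun x _ => ?_
            have := congrFun (congrFun (S.curv_mul_H_skew l a) l) x
            rw [transpose_apply, Matrix.neg_apply] at this
            rw [this]; ring
        _ = ∑ x, -(Ω b x * (S.ric * S.H) a x) := by
            rw [Finset.sum_comm]
            refine Finset.sum_congr rfl fun x _ => ?_
            rw [Finset.sum_neg_distrib, ← Finset.mul_sum]
            congr 2
            simp only [mul_apply, ric_apply, Finset.sum_mul]
            rw [Finset.sum_comm]
        _ = _ := by
            rw [mul_assoc, mul_apply, ← Finset.sum_neg_distrib]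
            refine Finset.sum_congr rfl fun x _ => ?_
            rw [← S.H_symm, ← transpose_mul, transpose_apply, S.H_symm]
    have e3 : ∑ l, ∑ k, S.H l k * S.covLow₂ l a Ω b k
        = ∑ l, ∑ k, S.H l k * S.covLow₂ a l Ω b k
          - ∑ l, ∑ k, S.H l k * ((S.curv l a)ᵀ * Ω) b k
          - ∑ l, ∑ k, S.H l k * (Ω * S.curv l a) b k := by
      simp only [← Finset.sum_sub_distrib]
      refine Finset.sum_congr rfl fun l _ => Finset.sum_congr rfl fun k _ => ?_
      rw [S.covLow₂_comm l a, Matrix.sub_apply, Matrix.add_apply]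
      ring
    rw [e3, e0, e2, Finset.sum_congr rfl fun l _ => e1 l]
    ring
  have h3 : ∑ l, ∑ k, S.H l k * (S.H * S.covLow l Ω * (S.H * (S.covLow k Ω)ᵀ)).trace
      = 2 * ∑ a, ∑ b, Z a b * ∑ l, ∑ k, S.H l k * S.covLow₂ l a Ω b k := by
    simp only [h1, Finset.mul_sum]
    rw [Finset.sum_congr rfl fun l _ => Finset.sum_comm, Finset.sum_comm]
    refine Finset.sum_congr rfl fun a _ => ?_
    rw [Finset.sum_congr rfl fun l _ => Finset.sum_comm, Finset.sum_comm]
    exact Finset.sum_congr rfl fun b _ => Finset.sum_congr rfl fun l _ =>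
      Finset.sum_congr rfl fun k _ => by ring
  -- Substituting `2 Ric = 2λg + η` into the Ricci term produces the multiple of `|F|²` and the
  -- quartic `|η|²`.
  have h4 : 2 * ∑ a, ∑ b, Z a b * (Ω * S.H * S.ricᵀ) b a
      = 2 * c * (S.H * Ω * (S.H * Ω)).trace
        - (S.H * Ω * (S.H * Ω) * (S.H * Ω * (S.H * Ω))).trace := by
    have e : ∑ a, ∑ b, Z a b * (Ω * S.H * S.ricᵀ) b a = (Z * (Ω * S.H * S.ricᵀ)).trace := by
      simp only [Matrix.trace, diag_apply, mul_apply (M := Z)]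
    have e2 : 2 * (Z * (Ω * S.H * S.ricᵀ)).trace
        = (Z * (Ω * S.H * (S.ric + S.ric)ᵀ)).trace := by
      rw [transpose_add, mul_add, mul_add, trace_add]; ring
    rw [e, e2, hE]
    have e3 : Z * (Ω * S.H * ((c + c) • S.G + Ω * S.H * Ωᵀ)ᵀ)
        = (c + c) • (S.H * Ω * (S.H * Ω) * (S.H * S.G))
          - S.H * Ω * (S.H * Ω) * (S.H * Ω * (S.H * Ω)) := by
      rw [transpose_add, transpose_smul, S.G_symm, transpose_mul, transpose_mul, H_symm,
        transpose_transpose, hΩ.alt, hZdef]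
      simp only [mul_add, Matrix.mul_smul]
      noncomm_ring
    rw [e3, S.H_mul_G, mul_one, trace_sub, trace_smul, smul_eq_mul]
    ring
  have h5 : ∑ a, ∑ b, Z a b * ∑ l, ((S.G * S.curv l a)ᵀ * Z) b l
      = ∑ l, ∑ a, ∑ b, ∑ d, (S.G * S.curv l a) d b * (Z a b * Z d l) := by
    rw [Finset.sum_comm (s := Finset.univ (α := Fin n)) (t := Finset.univ) (f := fun l a =>
      ∑ b, ∑ d, (S.G * S.curv l a) d b * (Z a b * Z d l))]
    refine Finset.sum_congr rfl fun a _ => ?_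
    rw [Finset.sum_comm (f := fun l b => ∑ d, (S.G * S.curv l a) d b * (Z a b * Z d l))]
    refine Finset.sum_congr rfl fun b _ => ?_
    rw [Finset.mul_sum]
    refine Finset.sum_congr rfl fun l _ => ?_
    rw [mul_apply, Finset.mul_sum]
    refine Finset.sum_congr rfl fun d _ => ?_
    rw [transpose_apply]; ring
  rw [h3]
  simp only [h2, mul_add, mul_neg, Finset.sum_add_distrib, Finset.sum_neg_distrib]
  rw [h5]
  linear_combination h4

end IsHarmonicForm
end LeviCivita

/-! ### The ring of smooth functions on an open subset of `ℝⁿ` -/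

section SmoothFunctions

variable {n : ℕ}

theorem pd_congr {i : Fin n} {f g : Euc n → ℝ} {y : Euc n} (h : f =ᶠ[nhds y] g) :
    pd i f y = pd i g y := by
  rw [pd, pd, h.fderiv_eq]

theorem pd_add {i : Fin n} {f g : Euc n → ℝ} {y : Euc n} (hf : DifferentiableAt ℝ f y)
    (hg : DifferentiableAt ℝ g y) : pd i (f + g) y = pd i f y + pd i g y := by
  rw [pd, fderiv_add hf hg]; rfl

theorem pd_mul {i : Fin n} {f g : Euc n → ℝ} {y : Euc n} (hf : DifferentiableAt ℝ f y)
    (hg : DifferentiableAt ℝ g y) : pd i (f * g) y = f y * pd i g y + g y * pd i f y := by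
  rw [pd, fderiv_mul hf hg]; rfl

theorem pd_const (i : Fin n) (c : ℝ) (y : Euc n) : pd i (fun _ => c) y = 0 := by
  rw [pd, fderiv_fun_const]; rfl

theorem contDiffOn_pd {U : Set (Euc n)} (hU : IsOpen U) {f : Euc n → ℝ}
    (hf : ContDiffOn ℝ ∞ f U) (i : Fin n) : ContDiffOn ℝ ∞ (pd i f) U :=
  (hf.fderiv_of_isOpen hU (m := ∞) (by simp)).clm_apply contDiffOn_const

theorem pd_comm {f : Euc n → ℝ} {y : Euc n} (hf : ContDiffAt ℝ ∞ f y) (i j : Fin n) :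
    pd i (pd j f) y = pd j (pd i f) y := by
  have hd : DifferentiableAt ℝ (fderiv ℝ f) y :=
    (hf.fderiv_right (m := 1) (by norm_cast)).differentiableAt one_ne_zero
  have h : ∀ a b : Fin n, pd a (pd b f) y
      = fderiv ℝ (fderiv ℝ f) y (EuclideanSpace.single a 1) (EuclideanSpace.single b 1) := by
    intro a b
    have : pd b f = fun z => fderiv ℝ f z (EuclideanSpace.single b 1) := rfl
    rw [pd, this, fderiv_clm_apply hd (differentiableAt_const _)]
    simp
  rw [h, h]
  have h2 : (2 : WithTop ℕ∞) ≤ ∞ := WithTop.coe_le_coe.2 (le_top : (2 : ℕ∞) ≤ ⊤)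
  exact (hf.isSymmSndFDerivAt (by simpa using h2)) _ _

variable (U : TopologicalSpace.Opens (Euc n))

/-- Extension by zero. -/
def extendZero {U : TopologicalSpace.Opens (Euc n)} (f : U → ℝ) : Euc n → ℝ :=
  Function.extend Subtype.val f 0

theorem extendZero_coe {U : TopologicalSpace.Opens (Euc n)} (f : U → ℝ) (y : U) :
    extendZero f y = f y :=
  Subtype.val_injective.extend_apply _ _ _

theorem extendZero_restrict (f : Euc n → ℝ) :
    Set.EqOn (extendZero fun y : U => f y) f U := fun y hy =>
  extendZero_coe (fun y : U => f y) ⟨y, hy⟩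

/-- The algebra of smooth functions on `U`. -/
def smoothFun : Subalgebra ℝ (U → ℝ) where
  -- Smoothness is tested only on `U`, so the junk value 0 outside is harmless.
  carrier := {f | ContDiffOn ℝ ∞ (extendZero f) U}
  mul_mem' {f g} hf hg := (hf.mul hg).congr fun y hy => by
    simp [extendZero_coe _ (⟨y, hy⟩ : U)]
  add_mem' {f g} hf hg := (hf.add hg).congr fun y hy => by
    simp [extendZero_coe _ (⟨y, hy⟩ : U)]
  algebraMap_mem' r := (contDiffOn_const (c := r)).congr fun y hy => by
    simp [extendZero_coe _ (⟨y, hy⟩ : U)]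

namespace smoothFun

variable {U}

/-- Restriction to `U` of a function which is smooth on `U`. -/
def mk (f : Euc n → ℝ) (hf : ContDiffOn ℝ ∞ f U) : smoothFun U :=
  ⟨fun y => f y, hf.congr (extendZero_restrict U f)⟩

theorem contDiffAt (f : smoothFun U) (y : U) : ContDiffAt ℝ ∞ (extendZero f.1) y :=
  f.2.contDiffAt (U.isOpen.mem_nhds y.2)

theorem differentiableAt (f : smoothFun U) (y : U) : DifferentiableAt ℝ (extendZero f.1) y :=
  (smoothFun.contDiffAt f y).differentiableAt (by simp)

/-- `U` is open, so derivatives at its points can be computed with any function agreeing on `U`. -/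
theorem extendZero_eventuallyEq (f : smoothFun U) (g : Euc n → ℝ) (y : U)
    (h : ∀ z : U, f.1 z = g z) : extendZero f.1 =ᶠ[nhds (y : Euc n)] g := by
  filter_upwards [U.isOpen.mem_nhds y.2] with z hz
  rw [extendZero_coe f.1 ⟨z, hz⟩, h]

/-- The partial derivatives, as derivations of the algebra of smooth functions on `U`. -/
def deriv (i : Fin n) : Derivation ℤ (smoothFun U) (smoothFun U) :=
  Derivation.mk'
    (AddMonoidHom.toIntLinearMap
      { toFun := fun f => mk (pd i (extendZero f.1)) (contDiffOn_pd U.isOpen f.2 i)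
        map_zero' := by
          ext y
          have := extendZero_eventuallyEq (0 : smoothFun U) (fun _ => 0) y fun _ => rfl
          exact (pd_congr this).trans (pd_const i 0 y)
        map_add' := fun f g => by
          ext y
          have := extendZero_eventuallyEq (f + g) (extendZero f.1 + extendZero g.1) y fun z => by
            simp [extendZero_coe]
          exact (pd_congr this).trans (pd_add (smoothFun.differentiableAt f y) (smoothFun.differentiableAt g y)) })
    fun f g => by
      ext y
      have := extendZero_eventuallyEq (f * g) (extendZero f.1 * extendZero g.1) y fun z => by
        simp [extendZero_coe]
      refine (pd_congr this).trans ?_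
      rw [pd_mul (smoothFun.differentiableAt f y) (smoothFun.differentiableAt g y), extendZero_coe, extendZero_coe]
      rfl

theorem deriv_apply (i : Fin n) (f : smoothFun U) (g : Euc n → ℝ) (h : ∀ z : U, f.1 z = g z)
    (y : U) : (deriv i f).1 y = pd i g y :=
  pd_congr (extendZero_eventuallyEq f g y h)

theorem deriv_comm (i j : Fin n) (f : smoothFun U) :
    deriv i (deriv j f) = deriv j (deriv i f) := by
  ext y
  rw [deriv_apply i (deriv j f) (pd j (extendZero f.1)) fun _ => rfl,
    deriv_apply j (deriv i f) (pd i (extendZero f.1)) fun _ => rfl, pd_comm (smoothFun.contDiffAt f y)]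

/-- Evaluation at a point. -/
def eval (y : U) : smoothFun U →+* ℝ := (Pi.evalRingHom _ y).comp (smoothFun U).val.toRingHom

theorem ext_eval {f g : smoothFun U} (h : ∀ y, eval y f = eval y g) : f = g :=
  Subtype.ext (funext h)

end smoothFun

end SmoothFunctions

/-! ### Metrics on open subsets of `ℝⁿ` -/

section

variable {n : ℕ} {U : Set (Euc n)} {G : Euc n → Matrix (Fin n) (Fin n) ℝ}

theorem contDiffOn_det {m : ℕ} {G : Euc n → Matrix (Fin m) (Fin m) ℝ}
    (hG : ∀ i j, ContDiffOn ℝ ∞ (fun y => G y i j) U) :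
    ContDiffOn ℝ ∞ (fun y => (G y).det) U := by
  simp only [Matrix.det_apply']
  exact ContDiffOn.sum fun σ _ => contDiffOn_const.mul (contDiffOn_prod fun i _ => hG _ _)

theorem contDiffOn_inv (hG : ∀ i j, ContDiffOn ℝ ∞ (fun y => G y i j) U)
    (hdet : ∀ y ∈ U, (G y).det ≠ 0) (i j : Fin n) :
    ContDiffOn ℝ ∞ (fun y => (G y)⁻¹ i j) U := by
  simp only [Matrix.inv_def, Matrix.smul_apply, Ring.inverse_eq_inv', smul_eq_mul,
    Matrix.adjugate_apply]
  refine ((contDiffOn_det hG).inv hdet).mul (contDiffOn_det fun a b => ?_)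
  by_cases h : a = j
  · simp only [h, Matrix.updateRow_self]; exact contDiffOn_const
  · simp only [Matrix.updateRow_ne h]; exact hG a b

theorem contDiffOn_christoffel (hU : IsOpen U) (hG : ∀ i j, ContDiffOn ℝ ∞ (fun y => G y i j) U)
    (hdet : ∀ y ∈ U, (G y).det ≠ 0) (k i j : Fin n) :
    ContDiffOn ℝ ∞ (christoffel G k i j) U := by
  refine contDiffOn_const.mul (ContDiffOn.sum fun l _ => (contDiffOn_inv hG hdet k l).mul ?_)
  exact ((contDiffOn_pd hU (hG _ _) _).add (contDiffOn_pd hU (hG _ _) _)).sub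
    (contDiffOn_pd hU (hG _ _) _)

/-- `∇g = 0`: lowering the upper index of `Γ` cancels the inverse metric, and the two Christoffel
symbols of the first kind add up to `∂_k g_ij`. -/
theorem pd_metric {y : Euc n} (hU : U ∈ nhds y) (hsymm : ∀ y ∈ U, (G y).transpose = G y)
    (hdet : (G y).det ≠ 0) (i j k : Fin n) :
    pd k (fun z => G z i j) y
      = ∑ m, G y i m * christoffel G m k j y + ∑ m, christoffel G m k i y * G y m j := by
  have hs : ∀ a b c, pd a (fun z => G z b c) y = pd a (fun z => G z c b) y := fun a b c =>
    pd_congr <| by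
      filter_upwards [hU] with z hz
      exact (congrFun (congrFun (hsymm z hz) c) b :)
  have h1 : ∀ i j, ∑ m, G y i m * christoffel G m k j y
      = (1 / 2) * (pd k (fun z => G z j i) y + pd j (fun z => G z k i) y
          - pd i (fun z => G z k j) y) := by
    intro i j
    set v : Fin n → ℝ := fun l => pd k (fun z => G z j l) y + pd j (fun z => G z k l) y
      - pd l (fun z => G z k j) y with hv
    have : (G y).mulVec ((G y)⁻¹.mulVec v) i = v i := by
      rw [Matrix.mulVec_mulVec, Matrix.mul_nonsing_inv _ (isUnit_iff_ne_zero.2 hdet),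
        Matrix.one_mulVec]
    rw [show _ = (1 / 2) * v i from rfl, ← this]
    simp only [Matrix.mulVec, dotProduct, christoffel, Finset.mul_sum]
    refine Finset.sum_congr rfl fun m _ => Finset.sum_congr rfl fun l _ => ?_
    rw [hv]; ring
  have h2 : ∑ m, christoffel G m k i y * G y m j = ∑ m, G y j m * christoffel G m k i y :=
    Finset.sum_congr rfl fun m _ => by
      rw [mul_comm, ← congrFun (congrFun (hsymm y (mem_of_mem_nhds hU)) m) j,
        Matrix.transpose_apply]
  rw [h2, h1, h1, hs k j i, hs j k i, hs i k j]
  ring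

theorem christoffel_symm {y : Euc n} (hU : U ∈ nhds y) (hsymm : ∀ y ∈ U, (G y).transpose = G y)
    (k i j : Fin n) : christoffel G k i j y = christoffel G k j i y := by
  have hs : ∀ a b c, pd a (fun z => G z b c) y = pd a (fun z => G z c b) y := fun a b c =>
    pd_congr <| by
      filter_upwards [hU] with z hz
      exact (congrFun (congrFun (hsymm z hz) c) b :)
  simp only [christoffel]
  congr 1
  refine Finset.sum_congr rfl fun l _ => ?_
  rw [hs l i j]; ring

end

/-- Data on an open subset of `ℝⁿ` which satisfy the Einstein Yang-Mills equations. -/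
structure IsLocalEYM {n : ℕ} (U : TopologicalSpace.Opens (Euc n))
    (G Ω : Euc n → Matrix (Fin n) (Fin n) ℝ) (lam : ℝ) : Prop where
  smooth_metric : ∀ i j, ContDiffOn ℝ ∞ (fun y => G y i j) U
  posDef : ∀ y ∈ U, (G y).PosDef
  smooth_form : ∀ i j, ContDiffOn ℝ ∞ (fun y => Ω y i j) U
  alt : ∀ y ∈ U, (Ω y).transpose = -Ω y
  closed : ∀ y ∈ U, ∀ k i j, pd k (fun z => Ω z i j) y + pd i (fun z => Ω z j k) y
    + pd j (fun z => Ω z k i) y = 0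
  einstein : ∀ y ∈ U, ∀ i j, ricci G i j y - (1 / 2) * eta G Ω i j y = lam * G y i j
  coclosed : ∀ y ∈ U, ∀ j, codiff G Ω j y = 0

namespace IsLocalEYM

variable {n : ℕ} {U : TopologicalSpace.Opens (Euc n)}
  {G Ω : Euc n → Matrix (Fin n) (Fin n) ℝ} {lam : ℝ} (h : IsLocalEYM U G Ω lam)
include h

theorem symm : ∀ y ∈ U, (G y).transpose = G y := fun y hy => by
  simpa [Matrix.conjTranspose_eq_transpose_of_trivial] using (h.posDef y hy).1.eq

theorem det_ne_zero : ∀ y ∈ U, (G y).det ≠ 0 := fun y hy => (h.posDef y hy).det_pos.ne'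

/-- The Levi-Civita calculus on `U`. -/
def leviCivita : LeviCivita n (smoothFun U) where
  d := smoothFun.deriv
  d_comm := smoothFun.deriv_comm
  G := Matrix.of fun i j => smoothFun.mk _ (h.smooth_metric i j)
  H := Matrix.of fun i j => smoothFun.mk _ (contDiffOn_inv h.smooth_metric h.det_ne_zero i j)
  Γ := fun i => Matrix.of fun k j => smoothFun.mk _
    (contDiffOn_christoffel U.isOpen h.smooth_metric h.det_ne_zero k i j)
  G_symm := by
    ext i j y
    exact congrFun (congrFun (h.symm y y.2) i) j
  G_mul_H := by
    refine Matrix.ext fun i j => ?_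
    refine smoothFun.ext_eval fun y => ?_
    have := congrFun (congrFun (Matrix.mul_nonsing_inv _
      (isUnit_iff_ne_zero.2 (h.det_ne_zero y y.2))) i) j
    rw [Matrix.mul_apply, map_sum]
    simp only [map_mul]
    refine ((Matrix.mul_apply ..).symm.trans this).trans ?_
    by_cases hij : i = j <;> simp [Matrix.one_apply, hij]
  torsion_free := fun i j k => by
    refine smoothFun.ext_eval fun y => ?_
    exact christoffel_symm (U.isOpen.mem_nhds y.2) h.symm k i j
  compat := fun k => by
    refine Matrix.ext fun i j => ?_
    refine smoothFun.ext_eval fun y => ?_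
    refine (smoothFun.deriv_apply k (smoothFun.mk _ (h.smooth_metric i j)) (fun z => G z i j)
      (fun _ => rfl) y).trans ?_
    rw [pd_metric (U.isOpen.mem_nhds y.2) h.symm (h.det_ne_zero y y.2), Matrix.add_apply,
      Matrix.mul_apply, Matrix.mul_apply, map_add, map_sum, map_sum]
    simp only [map_mul]
    rfl

/-- The components of the 2-form. -/
def form : Matrix (Fin n) (Fin n) (smoothFun U) :=
  Matrix.of fun i j => smoothFun.mk _ (h.smooth_form i j)

open smoothFun in
theorem eval_G (y : U) (i j : Fin n) : eval y (h.leviCivita.G i j) = G y i j := rfl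

open smoothFun in
theorem eval_H (y : U) (i j : Fin n) : eval y (h.leviCivita.H i j) = (G y)⁻¹ i j := rfl

open smoothFun in
theorem eval_form (y : U) (i j : Fin n) : eval y (h.form i j) = Ω y i j := rfl

open smoothFun in
theorem eval_curv (y : U) (i j l k : Fin n) :
    eval y (h.leviCivita.curv i j l k) = riemann G l i j k y := by
  have hd : ∀ a b, eval y (h.leviCivita.d a (h.leviCivita.Γ b l k))
      = pd a (christoffel G l b k) y := fun a b => deriv_apply a _ _ (fun _ => rfl) y
  simp only [LeviCivita.curv, Matrix.sub_apply, Matrix.add_apply, Matrix.mul_apply,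
    LeviCivita.dm_apply, map_add, map_sub, map_sum, map_mul, hd, riemann, Finset.sum_sub_distrib]
  rfl

open smoothFun in
theorem eval_covLow (y : U) (k i j : Fin n) :
    eval y (h.leviCivita.covLow k h.form i j) = nabla G Ω k i j y := by
  have hd : eval y (h.leviCivita.d k (h.form i j)) = pd k (fun z => Ω z i j) y :=
    deriv_apply k _ _ (fun _ => rfl) y
  simp only [LeviCivita.covLow, Matrix.sub_apply, Matrix.mul_apply,
    LeviCivita.dm_apply, map_sub, map_sum, map_mul, hd, nabla, Finset.sum_add_distrib,
    Matrix.transpose_apply, mul_comm (eval y (h.form i _))]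
  rw [sub_sub]
  rfl

theorem isHarmonicForm : h.leviCivita.IsHarmonicForm h.form where
  alt := by
    ext i j y
    exact congrFun (congrFun (h.alt y y.2) i) j
  closed := fun k i j => by
    refine smoothFun.ext_eval fun y => ?_
    rw [map_add, map_add, map_zero, ← h.closed y y.2 k i j]
    congr 1
    · congr 1
      · exact smoothFun.deriv_apply k _ _ (fun _ => rfl) y
      · exact smoothFun.deriv_apply i _ _ (fun _ => rfl) y
    · exact smoothFun.deriv_apply j _ _ (fun _ => rfl) y
  coclosed := fun j => by
    refine smoothFun.ext_eval fun y => ?_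
    have := h.coclosed y y.2 j
    rw [codiff, neg_eq_zero] at this
    simpa only [map_sum, map_mul, h.eval_covLow, h.eval_H, map_zero] using this

/-- The equation is doubled to match the hypothesis of the abstract calculus, whose ring need not
contain `1/2`. -/
theorem einstein_form : h.leviCivita.ric + h.leviCivita.ric
    = (algebraMap ℝ (smoothFun U) lam + algebraMap ℝ (smoothFun U) lam) • h.leviCivita.G
      + h.form * h.leviCivita.H * h.form.transpose := by
  refine Matrix.ext fun i j => ?_
  refine smoothFun.ext_eval fun y => ?_
  have hc : smoothFun.eval y (algebraMap ℝ (smoothFun U) lam) = lam := rfl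
  have he := h.einstein y y.2 i j
  have h2 : smoothFun.eval y ((h.form * h.leviCivita.H * h.form.transpose) i j)
      = eta G Ω i j y := by
    simp only [Matrix.mul_apply, Matrix.transpose_apply, map_sum, map_mul, eval_form, eval_H, eta,
      Finset.sum_mul]
    rw [Finset.sum_comm]
    exact Finset.sum_congr rfl fun _ _ => Finset.sum_congr rfl fun _ _ => by ring
  have h1 : smoothFun.eval y (h.leviCivita.ric i j) = ricci G i j y := by
    simp only [LeviCivita.ric_apply, map_sum, eval_curv, ricci]
  rw [Matrix.add_apply, Matrix.add_apply, Matrix.smul_apply, smul_eq_mul, map_add, map_add,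
    map_mul, map_add, h2, h1, hc, eval_G]
  linarith

end IsLocalEYM

/-! ### Norms of tensors -/

section TensorNorm

open Matrix

variable {n : ℕ}

theorem sum_index_succ {k : ℕ} (f : (Fin (k + 1) → Fin n) → ℝ) :
    ∑ I, f I = ∑ i, ∑ I : Fin k → Fin n, f (Fin.cons i I) := by
  rw [← (Fin.consEquiv fun _ : Fin (k + 1) => Fin n).sum_comp, Fintype.sum_prod_type]
  rfl

theorem sum_index_zero (f : (Fin 0 → Fin n) → ℝ) : ∑ I, f I = f ![] := by
  rw [Fintype.sum_unique]
  exact congrArg f (Subsingleton.elim _ _)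

theorem sum_index_two (f : (Fin 2 → Fin n) → ℝ) : ∑ I, f I = ∑ i, ∑ j, f ![i, j] := by
  simp only [sum_index_succ, sum_index_zero]; rfl

theorem sum_index_three (f : (Fin 3 → Fin n) → ℝ) :
    ∑ I, f I = ∑ i, ∑ j, ∑ k, f ![i, j, k] := by
  simp only [sum_index_succ, sum_index_zero]; rfl

theorem sum_index_four (f : (Fin 4 → Fin n) → ℝ) :
    ∑ I, f I = ∑ i, ∑ j, ∑ k, ∑ l, f ![i, j, k, l] := by
  simp only [sum_index_succ, sum_index_zero]; rfl

/-- The components of a covariant tensor in another frame. -/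
def changeFrame (L : Matrix (Fin n) (Fin n) ℝ) {k : ℕ} (T : (Fin k → Fin n) → ℝ)
    (K : Fin k → Fin n) : ℝ :=
  ∑ I : Fin k → Fin n, (∏ a, L (I a) (K a)) * T I

theorem prod_mul_transpose (L : Matrix (Fin n) (Fin n) ℝ) {k : ℕ} (I J : Fin k → Fin n) :
    ∏ a, (L * Lᵀ) (I a) (J a)
      = ∑ K : Fin k → Fin n, (∏ a, L (I a) (K a)) * ∏ a, L (J a) (K a) := by
  simp only [mul_apply, transpose_apply, Finset.prod_univ_sum, Fintype.piFinset_univ,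
    Finset.prod_mul_distrib]

/-- If `g⁻¹ = L Lᵀ`, the columns of `L` form an orthonormal frame, where the norm is Euclidean. -/
theorem tensorNormSq_eq_sum_sq (L : Matrix (Fin n) (Fin n) ℝ) {k : ℕ}
    (T : (Fin k → Fin n) → ℝ) : tensorNormSq (L * Lᵀ) T = ∑ K, changeFrame L T K ^ 2 := by
  simp only [tensorNormSq, prod_mul_transpose, changeFrame, sq, Finset.sum_mul_sum]
  simp only [Finset.sum_mul]
  rw [Finset.sum_congr rfl fun I _ => Finset.sum_comm, Finset.sum_comm]
  exact Finset.sum_congr rfl fun K _ => Finset.sum_congr rfl fun I _ =>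
    Finset.sum_congr rfl fun J _ => by ring

theorem sum_eq_trace (H X Y : Matrix (Fin n) (Fin n) ℝ) (hH : Hᵀ = H) :
    ∑ i, ∑ j, ∑ i', ∑ j', H i i' * H j j' * X i j * Y i' j' = (H * X * (H * Yᵀ)).trace := by
  have hs : ∀ i j, H i j = H j i := fun i j => congrFun (congrFun hH j) i
  simp only [Matrix.trace, diag_apply, mul_apply (M := H * X)]
  simp only [mul_apply, transpose_apply, Finset.sum_mul_sum]
  rw [Finset.sum_congr rfl fun i _ => Finset.sum_comm, Finset.sum_comm]
  refine Finset.sum_congr rfl fun i' _ => ?_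
  rw [Finset.sum_comm]
  exact Finset.sum_congr rfl fun j _ => Finset.sum_congr rfl fun i _ =>
    Finset.sum_congr rfl fun j' _ => by rw [hs i i']; ring

theorem tensorNormSq_two (H X : Matrix (Fin n) (Fin n) ℝ) (hH : Hᵀ = H) :
    tensorNormSq H (fun I : Fin 2 → Fin n => X (I 0) (I 1)) = (H * X * (H * Xᵀ)).trace := by
  rw [← sum_eq_trace _ _ _ hH]
  simp only [tensorNormSq, sum_index_two, Fin.prod_univ_two]
  rfl

theorem tensorNormSq_three (H : Matrix (Fin n) (Fin n) ℝ) (T : Fin n → Matrix (Fin n) (Fin n) ℝ)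
    (hH : Hᵀ = H) :
    tensorNormSq H (fun I : Fin 3 → Fin n => T (I 0) (I 1) (I 2))
      = ∑ l, ∑ k, H l k * (H * T l * (H * (T k)ᵀ)).trace := by
  have h : tensorNormSq H (fun I : Fin 3 → Fin n => T (I 0) (I 1) (I 2))
      = ∑ l, ∑ i, ∑ j, ∑ k, ∑ i', ∑ j', H l k * H i i' * H j j' * T l i j * T k i' j' := by
    simp only [tensorNormSq, sum_index_three, Fin.prod_univ_three]
    rfl
  rw [h]
  simp only [← sum_eq_trace _ _ _ hH, Finset.mul_sum]
  refine Finset.sum_congr rfl fun l _ => ?_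
  rw [Finset.sum_congr rfl fun i _ => Finset.sum_comm, Finset.sum_comm]
  exact Finset.sum_congr rfl fun k _ => Finset.sum_congr rfl fun i _ =>
    Finset.sum_congr rfl fun j _ => Finset.sum_congr rfl fun i' _ =>
      Finset.sum_congr rfl fun j' _ => by ring

/-- Brings the indices into the order in which a product of two double sums expands. -/
theorem sum_four_rotate (f : Fin n → Fin n → Fin n → Fin n → ℝ) :
    ∑ s, ∑ p, ∑ q, ∑ r, f s p q r = ∑ p, ∑ r, ∑ q, ∑ s, f s p q r := by
  rw [Finset.sum_comm]
  refine Finset.sum_congr rfl fun p _ => ?_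
  rw [Finset.sum_congr rfl fun s _ => Finset.sum_comm, Finset.sum_comm]
  exact Finset.sum_congr rfl fun r _ => Finset.sum_comm

/-- The components of `F` in an orthonormal frame. -/
theorem tensorNormSq_two_eq_sum_sq (L X : Matrix (Fin n) (Fin n) ℝ) :
    tensorNormSq (L * Lᵀ) (fun I : Fin 2 → Fin n => X (I 0) (I 1))
      = ∑ i, ∑ j, (Lᵀ * X * L) i j ^ 2 := by
  rw [tensorNormSq_eq_sum_sq, sum_index_two]
  refine Finset.sum_congr rfl fun i _ => Finset.sum_congr rfl fun j _ => ?_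
  congr 1
  simp only [changeFrame, sum_index_two, Fin.prod_univ_two, mul_apply, transpose_apply,
    cons_val_zero, cons_val_one, Finset.sum_mul]
  rw [Finset.sum_comm]
  exact Finset.sum_congr rfl fun _ _ => Finset.sum_congr rfl fun _ _ => by ring

open scoped MatrixOrder Matrix.Norms.L2Operator in
theorem exists_eq_mul_transpose {H : Matrix (Fin n) (Fin n) ℝ} (hH : H.PosSemidef) :
    ∃ L : Matrix (Fin n) (Fin n) ℝ, H = L * Lᵀ := by
  obtain ⟨B, hB⟩ := CStarAlgebra.nonneg_iff_eq_star_mul_self.mp hH.nonneg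
  exact ⟨Bᵀ, by rw [transpose_transpose, hB, star_eq_conjTranspose, conjTranspose_eq_transpose_of_trivial]⟩

theorem tensorNormSq_nonneg {H : Matrix (Fin n) (Fin n) ℝ} (hH : H.PosSemidef) {k : ℕ}
    (T : (Fin k → Fin n) → ℝ) : 0 ≤ tensorNormSq H T := by
  obtain ⟨L, rfl⟩ := exists_eq_mul_transpose hH
  rw [tensorNormSq_eq_sum_sq]
  exact Finset.sum_nonneg fun _ _ => sq_nonneg _

/-- In an orthonormal frame `X` becomes a skew `Y`, so `Y²` is symmetric and the trace is `|Y²|²`,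
that is, `|η|²`. -/
theorem trace_pow_four_nonneg {H X : Matrix (Fin n) (Fin n) ℝ} (hH : H.PosSemidef)
    (hX : Xᵀ = -X) : 0 ≤ (H * X * (H * X) * (H * X * (H * X))).trace := by
  obtain ⟨L, rfl⟩ := exists_eq_mul_transpose hH
  set Y := Lᵀ * X * L with hY
  have hYt : Yᵀ = -Y := by
    rw [hY, transpose_mul, transpose_mul, transpose_transpose, hX]; noncomm_ring
  have h : (L * Lᵀ * X * (L * Lᵀ * X) * (L * Lᵀ * X * (L * Lᵀ * X))).trace
      = (Y * Y * (Y * Y)ᵀ).trace := by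
    rw [transpose_mul, hYt, neg_mul_neg, hY]
    calc _ = (L * (Lᵀ * X * L * (Lᵀ * X * L) * (Lᵀ * X * L) * (Lᵀ * X))).trace := by
          congr 1; noncomm_ring
      _ = _ := by rw [trace_mul_comm]; congr 1; noncomm_ring
  rw [h]
  simp only [Matrix.trace, diag_apply, mul_apply (N := (Y * Y)ᵀ), transpose_apply]
  exact Finset.sum_nonneg fun _ _ => Finset.sum_nonneg fun _ _ => mul_self_nonneg _

/-- The quadratic action of a 4-tensor on 2-tensors is controlled by the product of the norms. -/
theorem abs_sum_four_le {H : Matrix (Fin n) (Fin n) ℝ} (hH : H.PosSemidef)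
    (T : Fin n → Fin n → Fin n → Fin n → ℝ) (X : Matrix (Fin n) (Fin n) ℝ) :
    |∑ l, ∑ a, ∑ b, ∑ d, T l a b d * ((H * X * H) a b * (H * X * H) d l)|
      ≤ Real.sqrt (tensorNormSq H fun I : Fin 4 → Fin n => T (I 0) (I 1) (I 2) (I 3))
        * tensorNormSq H (fun I : Fin 2 → Fin n => X (I 0) (I 1)) := by
  obtain ⟨L, rfl⟩ := exists_eq_mul_transpose hH
  set Y := Lᵀ * X * L with hY
  set T' : (Fin 4 → Fin n) → ℝ := fun I => T (I 0) (I 1) (I 2) (I 3) with hT'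
  have hZ : L * Lᵀ * X * (L * Lᵀ) = L * Y * Lᵀ := by rw [hY]; noncomm_ring
  have hW : ∀ a b, (L * Y * Lᵀ) a b = ∑ p, ∑ q, L a p * L b q * Y p q := by
    intro a b
    simp only [mul_apply, transpose_apply, Finset.sum_mul]
    rw [Finset.sum_comm]
    exact Finset.sum_congr rfl fun _ _ => Finset.sum_congr rfl fun _ _ => by ring
  have hsum : ∑ l, ∑ a, ∑ b, ∑ d, T l a b d * ((L * Y * Lᵀ) a b * (L * Y * Lᵀ) d l)
      = ∑ K : Fin 4 → Fin n, changeFrame L T' K * (Y (K 1) (K 2) * Y (K 3) (K 0)) := by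
    have h1 : ∀ I : Fin 4 → Fin n, (L * Y * Lᵀ) (I 1) (I 2) * (L * Y * Lᵀ) (I 3) (I 0)
        = ∑ K : Fin 4 → Fin n, (∏ a, L (I a) (K a)) * (Y (K 1) (K 2) * Y (K 3) (K 0)) := by
      intro I
      rw [hW, hW, sum_index_four, sum_four_rotate, Finset.sum_mul_sum]
      simp only [Finset.sum_mul_sum, Fin.prod_univ_four]
      refine Finset.sum_congr rfl fun p _ => Finset.sum_congr rfl fun r _ =>
        Finset.sum_congr rfl fun q _ => Finset.sum_congr rfl fun s _ => ?_
      change _ = L (I 0) s * L (I 1) p * L (I 2) q * L (I 3) r * (Y p q * Y r s)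
      ring
    have h2 : ∑ l, ∑ a, ∑ b, ∑ d, T l a b d * ((L * Y * Lᵀ) a b * (L * Y * Lᵀ) d l)
        = ∑ I : Fin 4 → Fin n,
          T' I * ((L * Y * Lᵀ) (I 1) (I 2) * (L * Y * Lᵀ) (I 3) (I 0)) := by
      rw [sum_index_four]; rfl
    rw [h2]
    simp only [h1, changeFrame, Finset.mul_sum, Finset.sum_mul]
    rw [Finset.sum_comm]
    exact Finset.sum_congr rfl fun _ _ => Finset.sum_congr rfl fun _ _ => by ring
  -- The 4-tensor `Y ⊗ Y` has norm exactly `|Y|²`, so Cauchy–Schwarz costs no dimensional constant.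
  have hsq : ∑ K : Fin 4 → Fin n, (Y (K 1) (K 2) * Y (K 3) (K 0)) ^ 2
      = (∑ i, ∑ j, Y i j ^ 2) ^ 2 := by
    rw [sum_index_four, sum_four_rotate, sq (∑ i, ∑ j, Y i j ^ 2), Finset.sum_mul_sum]
    simp only [Finset.sum_mul_sum]
    refine Finset.sum_congr rfl fun p _ => Finset.sum_congr rfl fun r _ =>
      Finset.sum_congr rfl fun q _ => Finset.sum_congr rfl fun s _ => ?_
    exact mul_pow (Y p q) (Y r s) 2
  have hf : 0 ≤ ∑ i, ∑ j, Y i j ^ 2 :=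
    Finset.sum_nonneg fun _ _ => Finset.sum_nonneg fun _ _ => sq_nonneg _
  rw [hZ, hsum, tensorNormSq_eq_sum_sq, tensorNormSq_two_eq_sum_sq, ← hY,
    ← Real.sqrt_sq hf, ← hsq, ← Real.sqrt_mul (Finset.sum_nonneg fun _ _ => sq_nonneg _)]
  exact Real.abs_le_sqrt (Finset.sum_mul_sq_le_sq_mul_sq _ _ _)

end TensorNorm

/-! ### Pointwise consequences of the equations in a chart -/

namespace IsLocalEYM

variable {n : ℕ} {U : TopologicalSpace.Opens (Euc n)}
  {G Ω : Euc n → Matrix (Fin n) (Fin n) ℝ} {lam : ℝ} (h : IsLocalEYM U G Ω lam)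
include h

theorem inv_symm {y : Euc n} (hy : y ∈ U) : ((G y)⁻¹).transpose = (G y)⁻¹ := by
  rw [Matrix.transpose_nonsing_inv, h.symm y hy]

theorem tensorNormSq_form {y : Euc n} (hy : y ∈ U) :
    tensorNormSq (G y)⁻¹ (fun I : Fin 2 → Fin n => Ω y (I 0) (I 1))
      = -((G y)⁻¹ * Ω y * ((G y)⁻¹ * Ω y)).trace := by
  rw [tensorNormSq_two _ _ (h.inv_symm hy), h.alt y hy, mul_neg, mul_neg, Matrix.trace_neg]

theorem mapMatrix_H (y : U) : (smoothFun.eval y).mapMatrix h.leviCivita.H = (G y)⁻¹ := rfl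

theorem mapMatrix_form (y : U) : (smoothFun.eval y).mapMatrix h.form = Ω y := rfl

omit h in
theorem eval_trace (y : U) (X : Matrix (Fin n) (Fin n) (smoothFun U)) :
    smoothFun.eval y X.trace = ((smoothFun.eval y).mapMatrix X).trace := by
  simp [Matrix.trace, map_sum]

/-- The norm of the 2-form of an Einstein Yang-Mills system has derivative zero. -/
theorem fderiv_tensorNormSq_form {y : Euc n} (hy : y ∈ U) :
    HasFDerivAt (fun z => tensorNormSq (G z)⁻¹ (fun I : Fin 2 → Fin n => Ω z (I 0) (I 1)))
      (0 : Euc n →L[ℝ] ℝ) y := by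
  -- For skew `Ω` this trace is `-|F|²`.
  set φ := (h.leviCivita.H * h.form * (h.leviCivita.H * h.form)).trace with hφ
  have hv : ∀ z : U, (-φ).1 z
      = tensorNormSq (G z)⁻¹ (fun I : Fin 2 → Fin n => Ω z (I 0) (I 1)) := by
    intro z
    rw [h.tensorNormSq_form z.2]
    have : smoothFun.eval z φ = ((G z)⁻¹ * Ω z * ((G z)⁻¹ * Ω z)).trace := by
      rw [hφ, eval_trace, map_mul, map_mul, mapMatrix_H, mapMatrix_form]
    rw [← this]; rfl
  have heq := smoothFun.extendZero_eventuallyEq (-φ)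
    (fun z => tensorNormSq (G z)⁻¹ (fun I : Fin 2 → Fin n => Ω z (I 0) (I 1))) ⟨y, hy⟩ hv
  have hd := (heq.differentiableAt_iff).1 (smoothFun.differentiableAt (-φ) ⟨y, hy⟩)
  have h0 : fderiv ℝ (fun z => tensorNormSq (G z)⁻¹ (fun I : Fin 2 → Fin n => Ω z (I 0) (I 1))) y
      = 0 := by
    have hpd : ∀ i : Fin n, fderiv ℝ (fun z => tensorNormSq (G z)⁻¹
        (fun I : Fin 2 → Fin n => Ω z (I 0) (I 1))) y (EuclideanSpace.single i 1) = 0 := by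
      intro i
      have h1 := smoothFun.deriv_apply i (-φ)
        (fun z => tensorNormSq (G z)⁻¹ (fun I : Fin 2 → Fin n => Ω z (I 0) (I 1))) hv ⟨y, hy⟩
      have h2 : smoothFun.deriv i (-φ) = 0 := by
        rw [map_neg, neg_eq_zero]
        exact h.isHarmonicForm.d_trace_sq_eq_zero (c := algebraMap ℝ _ lam) (fun k => by
          refine smoothFun.ext_eval fun y => ?_
          exact (smoothFun.deriv_apply k _ (fun _ => lam) (fun _ => rfl) y).trans
            (pd_const k lam y)) h.einstein_form i
      rw [h2] at h1
      exact h1.symm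
    refine ContinuousLinearMap.ext fun v => ?_
    rw [← (EuclideanSpace.basisFun (Fin n) ℝ).sum_repr v, map_sum]
    simp [hpd]
  rw [← h0]
  exact hd.hasFDerivAt

/-- The pointwise estimate of `|∇F|²` for an Einstein Yang-Mills system. -/
theorem tensorNormSq_nabla_le (hlam : |lam| ≤ 1) {y : Euc n} (hy : y ∈ U) :
    tensorNormSq (G y)⁻¹ (fun I : Fin 3 → Fin n => nabla G Ω (I 0) (I 1) (I 2) y)
      ≤ 2 * tensorNormSq (G y)⁻¹ (fun I : Fin 2 → Fin n => Ω y (I 0) (I 1))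
        * (Real.sqrt (tensorNormSq (G y)⁻¹
            fun I : Fin 4 → Fin n => riemannLow G (I 0) (I 1) (I 2) (I 3) y) + 1) := by
  have hH : ((G y)⁻¹).PosSemidef := (h.posDef y hy).inv.posSemidef
  set z : U := ⟨y, hy⟩ with hz
  have hb := congrArg (smoothFun.eval z)
    (h.isHarmonicForm.bochner (c := algebraMap ℝ _ lam) (fun k => by
      refine smoothFun.ext_eval fun y => ?_
      exact (smoothFun.deriv_apply k _ (fun _ => lam) (fun _ => rfl) y).trans
        (pd_const k lam y)) h.einstein_form)
  have hc : smoothFun.eval z (algebraMap ℝ (smoothFun U) lam) = lam := rfl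
  have hcov : ∀ k, (smoothFun.eval z).mapMatrix (h.leviCivita.covLow k h.form)
      = Matrix.of fun i j => nabla G Ω k i j y := by
    intro k; ext i j; exact h.eval_covLow z k i j
  have hcovt : ∀ k, (smoothFun.eval z).mapMatrix (h.leviCivita.covLow k h.form).transpose
      = (Matrix.of fun i j => nabla G Ω k i j y).transpose := by
    intro k; ext i j; exact h.eval_covLow z k j i
  have hR : ∀ l a d b, smoothFun.eval z ((h.leviCivita.G * h.leviCivita.curv l a) d b)
      = riemannLow G l a b d y := by
    intro l a d b
    simp only [Matrix.mul_apply, map_sum, map_mul, eval_curv, eval_G, riemannLow]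
    rfl
  have hZ : ∀ a b, smoothFun.eval z ((h.leviCivita.H * h.form * h.leviCivita.H) a b)
      = ((G y)⁻¹ * Ω y * (G y)⁻¹) a b := by
    intro a b
    have : (smoothFun.eval z).mapMatrix (h.leviCivita.H * h.form * h.leviCivita.H)
        = (G y)⁻¹ * Ω y * (G y)⁻¹ := by
      rw [map_mul, map_mul, mapMatrix_H, mapMatrix_form]
    exact congrFun (congrFun this a) b
  simp only [map_add, map_sub, map_sum, map_mul, map_neg, map_ofNat, hc, eval_trace, mapMatrix_H,
    mapMatrix_form, hcov, hcovt, hR, hZ, eval_H] at hb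
  rw [show (z : Euc n) = y from rfl] at hb
  have h0 := tensorNormSq_three _ (fun k => Matrix.of fun i j => nabla G Ω k i j y)
    (h.inv_symm hy)
  simp only [Matrix.of_apply] at h0
  rw [h0, hb]
  have h1 := (abs_le.1 (abs_sum_four_le hH (fun i j k l => riemannLow G i j k l y) (Ω y))).1
  have h2 := trace_pow_four_nonneg hH (h.alt y hy)
  have h3 := tensorNormSq_nonneg hH (fun I : Fin 2 → Fin n => Ω y (I 0) (I 1))
  have h4 := h.tensorNormSq_form hy
  have h5 := (abs_le.1 hlam).1
  set f := tensorNormSq (G y)⁻¹ (fun I : Fin 2 → Fin n => Ω y (I 0) (I 1))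
  have h6 : ((G y)⁻¹ * Ω y * ((G y)⁻¹ * Ω y)).trace = -f := by rw [h4, neg_neg]
  rw [h6]
  -- The quartic term has a favourable sign and is dropped; `lam ≥ -1` bounds `-2 lam f` by `2 f`.
  nlinarith [mul_nonneg (by linarith : 0 ≤ lam + 1) h3]

end IsLocalEYM

/-! ### Smooth maps from `ℝⁿ` into a manifold -/

section Pullback

variable {n m : ℕ} {P : Type*} [TopologicalSpace P] [ChartedSpace (Euc m) P]
  [IsManifold (𝓡 m) ∞ P]

omit [IsManifold (𝓡 m) ∞ P] in
theorem oneForm_congr (A : OneForm m P) {p q : P} (h : p = q) {v w : Euc m} (hv : v = w) :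
    A p v = A q w := by
  subst h hv; rfl

omit [IsManifold (𝓡 m) ∞ P] in
theorem twoForm_congr (B : TwoForm m P) {p q : P} (h : p = q) {v v' w w' : Euc m} (hv : v = v')
    (hw : w = w') : B p v w = B q v' w' := by
  subst h hv hw; rfl

theorem contMDiffAt_mfderiv_const_vec {s : Euc n → P} {y : Euc n}
    (hs : ContMDiffAt (𝓡 n) (𝓡 m) ∞ s y) (v : Euc n) :
    ContMDiffAt (𝓡 n) (𝓡 m).tangent ∞
      (fun z => TotalSpace.mk' (Euc m) (E := fun p : P => TangentSpace (𝓡 m) p) (s z)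
        (mfderiv (𝓡 n) (𝓡 m) s z v)) y := by
  have h1 : IsManifold (𝓡 m) 1 P := .of_le (n := ∞) (by simp)
  refine ContMDiffAt.clm_apply_of_inCoordinates (F₁ := Euc n) (F₂ := Euc m)
    (B₁ := Euc n) (B₂ := P) (IB₁ := 𝓡 n) (IB₂ := 𝓡 m) (b₁ := fun z : Euc n => z) (b₂ := s)
    (E₁ := fun z : Euc n => TangentSpace (𝓡 n) z) (E₂ := fun p : P => TangentSpace (𝓡 m) p)
    (ϕ := fun z => mfderiv (𝓡 n) (𝓡 m) s z) (v := fun _ => v) ?_ ?_ hs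
  · exact ContMDiffAt.mfderiv_const hs (by simp)
  · exact contMDiffAt_vectorSpace_iff_contDiffAt.2 contDiffAt_const

/-- The components of the pullback of a smooth 1-form are smooth. -/
theorem contDiffAt_oneForm_comp {A : OneForm m P}
    (hA : ContMDiff (𝓡 m) ((𝓡 m).prod 𝓘(ℝ, Euc m →L[ℝ] ℝ)) ∞
      (fun p : P => TotalSpace.mk' (Euc m →L[ℝ] ℝ)
        (E := fun p : P => TangentSpace (𝓡 m) p →L[ℝ] Bundle.Trivial P ℝ p) p (A p)))
    {s : Euc n → P} {y : Euc n} (hs : ContMDiffAt (𝓡 n) (𝓡 m) ∞ s y) (v : Euc n) :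
    ContDiffAt ℝ ∞ (fun z => A (s z) (mfderiv (𝓡 n) (𝓡 m) s z v)) y := by
  have h := ContMDiffAt.clm_bundle_apply (F₁ := Euc m) (F₂ := ℝ) (b := s)
    (E₁ := fun p : P => TangentSpace (𝓡 m) p) (E₂ := Bundle.Trivial P ℝ)
    (ϕ := fun z => A (s z)) (v := fun z => mfderiv (𝓡 n) (𝓡 m) s z v)
    (hA.contMDiffAt.comp y hs) (contMDiffAt_mfderiv_const_vec hs v)
  rw [contMDiffAt_totalSpace] at h
  exact h.2.contDiffAt

/-- The components of the pullback of a smooth field of bilinear forms are smooth. -/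
theorem contDiffAt_bilinear_comp {B : TwoForm m P}
    (hB : ContMDiff (𝓡 m) ((𝓡 m).prod 𝓘(ℝ, Euc m →L[ℝ] Euc m →L[ℝ] ℝ)) ∞
      (fun p : P => TotalSpace.mk' (Euc m →L[ℝ] Euc m →L[ℝ] ℝ)
        (E := fun p : P => TangentSpace (𝓡 m) p →L[ℝ] TangentSpace (𝓡 m) p →L[ℝ] ℝ) p (B p)))
    {s : Euc n → P} {y : Euc n} (hs : ContMDiffAt (𝓡 n) (𝓡 m) ∞ s y) (v w : Euc n) :
    ContDiffAt ℝ ∞ (fun z => B (s z) (mfderiv (𝓡 n) (𝓡 m) s z v)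
      (mfderiv (𝓡 n) (𝓡 m) s z w)) y := by
  have h := ContMDiffAt.clm_bundle_apply₂ (F₁ := Euc m) (F₂ := Euc m) (F₃ := ℝ) (b := s)
    (E₁ := fun p : P => TangentSpace (𝓡 m) p) (E₂ := fun p : P => TangentSpace (𝓡 m) p)
    (E₃ := Bundle.Trivial P ℝ)
    (ψ := fun z => B (s z)) (v := fun z => mfderiv (𝓡 n) (𝓡 m) s z v)
    (w := fun z => mfderiv (𝓡 n) (𝓡 m) s z w)
    (hB.contMDiffAt.comp y hs) (contMDiffAt_mfderiv_const_vec hs v)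
    (contMDiffAt_mfderiv_const_vec hs w)
  rw [contMDiffAt_totalSpace] at h
  exact h.2.contDiffAt

/-- The exterior derivative commutes with pullback. -/
theorem extDerivOneForm_comp {A : OneForm m P}
    (hA : ContMDiff (𝓡 m) ((𝓡 m).prod 𝓘(ℝ, Euc m →L[ℝ] ℝ)) ∞
      (fun p : P => TotalSpace.mk' (Euc m →L[ℝ] ℝ)
        (E := fun p : P => TangentSpace (𝓡 m) p →L[ℝ] Bundle.Trivial P ℝ p) p (A p)))
    {s : Euc n → P} {y : Euc n} (hs : ContMDiffAt (𝓡 n) (𝓡 m) ∞ s y) (v w : Euc n) :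
    extDerivOneForm A (s y) (mfderiv (𝓡 n) (𝓡 m) s y v) (mfderiv (𝓡 n) (𝓡 m) s y w)
      = fderiv ℝ (fun z => A (s z) (mfderiv (𝓡 n) (𝓡 m) s z w)) y v
        - fderiv ℝ (fun z => A (s z) (mfderiv (𝓡 n) (𝓡 m) s z v)) y w := by
  have h1 : IsManifold (𝓡 m) 1 P := .of_le (n := ∞) (by simp)
  set e := chartAt (Euc m) (s y) with he
  have hed : e.MDifferentiable (𝓡 m) (𝓡 m) := mdifferentiable_chart (s y)
  have hys : s y ∈ e.source := mem_chart_source _ _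
  set S : Euc n → Euc m := e ∘ s with hS
  set a : Euc m → (Euc m →L[ℝ] ℝ) := fun z =>
    (A (e.symm z)).comp (mfderiv 𝓘(ℝ, Euc m) (𝓡 m) e.symm z) with ha
  have hSsm : ContDiffAt ℝ ∞ S y :=
    ((contMDiffAt_of_mem_maximalAtlas (IsManifold.chart_mem_maximalAtlas (s y)) hys).comp y
      hs).contDiffAt
  have hasm : DifferentiableAt ℝ a (S y) := by
    have : ContDiffOn ℝ ∞ a e.target := by
      refine contDiffOn_clm_apply.2 fun u z hz => ContDiffAt.contDiffWithinAt ?_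
      exact contDiffAt_oneForm_comp hA (contMDiffAt_symm_of_mem_maximalAtlas
        (IsManifold.chart_mem_maximalAtlas (s y)) hz) u
    exact (this.contDiffAt (e.open_target.mem_nhds (e.map_source hys))).differentiableAt (by simp)
  have hev : ∀ᶠ z in nhds y, s z ∈ e.source ∧ MDifferentiableAt (𝓡 n) (𝓡 m) s z :=
    (hs.continuousAt.eventually (e.open_source.mem_nhds hys)).and
      (((contMDiffAt_iff_contMDiffAt_nhds (n := 1) (by simp)).1 (hs.of_le (by simp))).mono
        fun z hz => hz.mdifferentiableAt one_ne_zero)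
  -- With `S` the coordinate expression of `s`, this is `s^*A = S^*a`, a statement between open sets
  -- of vector spaces.
  have hpull : ∀ u : Euc n, (fun z => A (s z) (mfderiv (𝓡 n) (𝓡 m) s z u))
      =ᶠ[nhds y] fun z => a (S z) (fderiv ℝ S z u) := by
    intro u
    filter_upwards [hev] with z hz
    have hz1 : (fderiv ℝ S z u : Euc m)
        = mfderiv (𝓡 m) 𝓘(ℝ, Euc m) e (s z) (mfderiv (𝓡 n) (𝓡 m) s z u) := by
      rw [← mfderiv_eq_fderiv, hS, mfderiv_comp z (hed.mdifferentiableAt hz.1) hz.2]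
      rfl
    refine oneForm_congr A (e.left_inv hz.1).symm ?_
    rw [hz1]
    exact (DFunLike.congr_fun (hed.symm_comp_deriv hz.1) (mfderiv (𝓡 n) (𝓡 m) s z u)).symm
  have hd : ∀ u u' : Euc n, fderiv ℝ (fun z => A (s z) (mfderiv (𝓡 n) (𝓡 m) s z u)) y u'
      = fderiv ℝ a (S y) (fderiv ℝ S y u') (fderiv ℝ S y u)
        + a (S y) (fderiv ℝ (fderiv ℝ S) y u' u) := by
    intro u u'
    rw [(hpull u).fderiv_eq]
    have hS1 : DifferentiableAt ℝ S y := hSsm.differentiableAt (by simp)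
    have hS2 : DifferentiableAt ℝ (fderiv ℝ S) y :=
      (hSsm.fderiv_right (m := 1) (by norm_cast)).differentiableAt one_ne_zero
    have h := (hasm.hasFDerivAt.comp y hS1.hasFDerivAt).clm_apply
      (hS2.hasFDerivAt.clm_apply (hasFDerivAt_const u y))
    have h' := congrArg (fun T : Euc n →L[ℝ] ℝ => T u') h.fderiv
    simp at h'
    rw [add_comm]
    exact h'
  have hv : ∀ u : Euc n, (mfderiv (𝓡 m) 𝓘(ℝ, Euc m) e (s y) (mfderiv (𝓡 n) (𝓡 m) s y u) : Euc m)
      = fderiv ℝ S y u := by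
    intro u
    rw [← mfderiv_eq_fderiv, hS, mfderiv_comp y (hed.mdifferentiableAt hys)
      (hs.mdifferentiableAt (by simp))]
    rfl
  -- The second derivatives of `S` cancel in the antisymmetrisation.
  have hsym : fderiv ℝ (fderiv ℝ S) y v w = fderiv ℝ (fderiv ℝ S) y w v :=
    hSsm.isSymmSndFDerivAt (by simpa using (ENat.LEInfty.out : (2 : WithTop ℕ∞) ≤ ∞)) v w
  have hgoal : extDerivOneForm A (s y) (mfderiv (𝓡 n) (𝓡 m) s y v) (mfderiv (𝓡 n) (𝓡 m) s y w)
      = fderiv ℝ a (S y) (fderiv ℝ S y v) (fderiv ℝ S y w)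
        - fderiv ℝ a (S y) (fderiv ℝ S y w) (fderiv ℝ S y v) := by
    rw [← hv, ← hv]; rfl
  rw [hgoal, hd, hd, hsym]
  ring

end Pullback

/-! ### The curvature of a connection in coordinates -/

section Curvature

variable {n : ℕ} {M : Type*} [TopologicalSpace M] [ChartedSpace (Euc n) M]
  {P : Type*} [TopologicalSpace P] [ChartedSpace (Euc (n + 1)) P] [MulAction Circle P]

/-- A principal bundle has smooth local sections, along which the projection is differentiable. -/
theorem IsPrincipalCircleBundle.exists_section {pr : P → M}
    (h : IsPrincipalCircleBundle (n := n) pr) (x : M) :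
    ∃ (U : Set M) (σ : M → P), IsOpen U ∧ x ∈ U ∧ (∀ z ∈ U, pr (σ z) = z) ∧
      (∀ z ∈ U, ContMDiffAt (𝓡 n) (𝓡 (n + 1)) ∞ σ z) ∧
      ∀ z ∈ U, MDifferentiableAt (𝓡 (n + 1)) (𝓡 n) pr (σ z) := by
  obtain ⟨U, Φ, hU, hx, hs, ht, hpr, -⟩ := h.exists_trivialization x
  have hmem : ∀ z ∈ U, (z, (1 : Circle)) ∈ Φ.target := fun z hz => by
    rw [ht]; exact ⟨hz, Set.mem_univ _⟩
  have hsrc : ∀ z ∈ U, Φ.toPartialEquiv.symm (z, 1) ∈ Φ.source := fun z hz =>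
    Φ.toPartialEquiv.map_target (hmem z hz)
  refine ⟨U, fun z => Φ.toPartialEquiv.symm (z, 1), hU, hx, fun z hz => ?_, fun z hz => ?_,
    fun z hz => ?_⟩
  · rw [← hpr _ (hsrc z hz)]
    exact congrArg Prod.fst (Φ.toPartialEquiv.right_inv (hmem z hz))
  · have h1 : ContMDiffAt ((𝓡 n).prod (𝓡 1)) (𝓡 (n + 1)) ∞ Φ.toPartialEquiv.symm
        (z, (1 : Circle)) :=
      Φ.contMDiffOn_invFun.contMDiffAt (Φ.open_target.mem_nhds (hmem z hz))
    exact h1.comp z (contMDiffAt_id.prodMk contMDiffAt_const)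
  · have h1 : ContMDiffAt (𝓡 (n + 1)) ((𝓡 n).prod (𝓡 1)) ∞ Φ.toPartialEquiv
        (Φ.toPartialEquiv.symm (z, 1)) :=
      Φ.contMDiffOn_toFun.contMDiffAt (Φ.open_source.mem_nhds (hsrc z hz))
    have h2 : ContMDiffAt (𝓡 (n + 1)) (𝓡 n) ∞ pr (Φ.toPartialEquiv.symm (z, 1)) := by
      refine h1.fst.congr_of_eventuallyEq ?_
      filter_upwards [Φ.open_source.mem_nhds (hsrc z hz)] with p hp using (hpr p hp).symm
    exact h2.mdifferentiableAt (by simp)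

variable [IsManifold (𝓡 (n + 1)) ∞ P]

/-- In coordinates, the curvature of a connection is locally the exterior derivative of a smooth
1-form. -/
theorem exists_potential {pr : P → M} {A : OneForm (n + 1) P} {F : TwoForm n M}
    (hpr : IsPrincipalCircleBundle (n := n) pr) (hA : IsConnectionForm (n := n) A)
    (hF : IsCurvatureOf F pr A) {e : OpenPartialHomeomorph M (Euc n)}
    (he : e ∈ IsManifold.maximalAtlas (𝓡 n) ∞ M) {y : Euc n} (hy : y ∈ e.target) :
    ∃ b : Fin n → Euc n → ℝ, (∀ i, ∀ᶠ z in nhds y, ContDiffAt ℝ ∞ (b i) z) ∧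
      ∀ᶠ z in nhds y, ∀ i j, coordForm F e z i j = pd i (b j) z - pd j (b i) z := by
  obtain ⟨U, σ, hU, hx, hσ, hσs, hprd⟩ := hpr.exists_section (e.symm y)
  set s : Euc n → P := fun z => σ (e.symm z) with hs
  have ht : ∀ᶠ z in nhds y, z ∈ e.target := e.open_target.mem_nhds hy
  have hV : ∀ᶠ z in nhds y, z ∈ e.target ∧ e.symm z ∈ U :=
    ht.and ((e.continuousAt_symm hy).eventually (hU.mem_nhds hx))
  have hes : ∀ z ∈ e.target, ContMDiffAt (𝓡 n) (𝓡 n) ∞ e.symm z := fun z hz =>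
    contMDiffAt_symm_of_mem_maximalAtlas he hz
  have hss : ∀ z, z ∈ e.target ∧ e.symm z ∈ U → ContMDiffAt (𝓡 n) (𝓡 (n + 1)) ∞ s z :=
    fun z hz => (hσs _ hz.2).comp z (hes z hz.1)
  -- The potential is the pullback of `A` by a local section. As `pr ∘ s = e.symm` near each point,
  -- pulling `pr^*F = dA` back by `s` gives `F` in coordinates.
  refine ⟨fun i z => A (s z) (mfderiv (𝓡 n) (𝓡 (n + 1)) s z (EuclideanSpace.single i (1 : ℝ))),
    fun i => ?_, ?_⟩
  · filter_upwards [hV] with z hz using contDiffAt_oneForm_comp hA.smooth (hss z hz) _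
  · filter_upwards [hV.eventually_nhds] with z hz i j
    have hz' := hz.self_of_nhds
    have hsz := hss z hz'
    have hd := extDerivOneForm_comp hA.smooth hsz (EuclideanSpace.single i (1 : ℝ))
      (EuclideanSpace.single j (1 : ℝ))
    rw [pd, pd, ← hd, ← hF]
    have hv : ∀ v : Euc n, (mfderiv (𝓡 n) (𝓡 n) e.symm z v : Euc n)
        = mfderiv (𝓡 (n + 1)) (𝓡 n) pr (s z) (mfderiv (𝓡 n) (𝓡 (n + 1)) s z v) := by
      intro v
      have h1 : mfderiv (𝓡 n) (𝓡 n) (pr ∘ s) z = mfderiv (𝓡 n) (𝓡 n) e.symm z := by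
        apply Filter.EventuallyEq.mfderiv_eq
        filter_upwards [hz] with w hw using hσ _ hw.2
      have h2 := mfderiv_comp z (hprd _ hz'.2) (hsz.mdifferentiableAt (by simp))
      exact (DFunLike.congr_fun h1 v).symm.trans (DFunLike.congr_fun h2 v)
    exact twoForm_congr F (hσ _ hz'.2).symm (hv _) (hv _)

/-- Smoothness of `F` is not part of the data; it is inherited from the potential. -/
theorem contDiffOn_coordForm {pr : P → M} {A : OneForm (n + 1) P} {F : TwoForm n M}
    (hpr : IsPrincipalCircleBundle (n := n) pr) (hA : IsConnectionForm (n := n) A)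
    (hF : IsCurvatureOf F pr A) {e : OpenPartialHomeomorph M (Euc n)}
    (he : e ∈ IsManifold.maximalAtlas (𝓡 n) ∞ M) (i j : Fin n) :
    ContDiffOn ℝ ∞ (fun y => coordForm F e y i j) e.target := by
  intro y hy
  obtain ⟨b, hb, hFb⟩ := exists_potential hpr hA hF he hy
  have hpd : ∀ i j, ContDiffAt ℝ ∞ (pd i (b j)) y := fun i j =>
    (((hb j).self_of_nhds).fderiv_right (m := ∞) (by simp)).clm_apply contDiffAt_const
  refine (((hpd i j).sub (hpd j i)).congr_of_eventuallyEq ?_).contDiffWithinAt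
  filter_upwards [hFb] with z hz using hz i j

theorem coordForm_alt {pr : P → M} {A : OneForm (n + 1) P} {F : TwoForm n M}
    (hpr : IsPrincipalCircleBundle (n := n) pr) (hA : IsConnectionForm (n := n) A)
    (hF : IsCurvatureOf F pr A) {e : OpenPartialHomeomorph M (Euc n)}
    (he : e ∈ IsManifold.maximalAtlas (𝓡 n) ∞ M) {y : Euc n} (hy : y ∈ e.target) :
    (coordForm F e y).transpose = -coordForm F e y := by
  obtain ⟨b, -, hFb⟩ := exists_potential hpr hA hF he hy
  ext i j
  rw [Matrix.transpose_apply, Matrix.neg_apply, hFb.self_of_nhds, hFb.self_of_nhds]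
  ring

theorem coordForm_closed {pr : P → M} {A : OneForm (n + 1) P} {F : TwoForm n M}
    (hpr : IsPrincipalCircleBundle (n := n) pr) (hA : IsConnectionForm (n := n) A)
    (hF : IsCurvatureOf F pr A) {e : OpenPartialHomeomorph M (Euc n)}
    (he : e ∈ IsManifold.maximalAtlas (𝓡 n) ∞ M) {y : Euc n} (hy : y ∈ e.target) (k i j : Fin n) :
    pd k (fun z => coordForm F e z i j) y + pd i (fun z => coordForm F e z j k) y
      + pd j (fun z => coordForm F e z k i) y = 0 := by
  obtain ⟨b, hb, hFb⟩ := exists_potential hpr hA hF he hy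
  have hpd : ∀ i j, DifferentiableAt ℝ (pd i (b j)) y := fun i j =>
    ((((hb j).self_of_nhds).fderiv_right (m := ∞) (by simp)).clm_apply
      contDiffAt_const).differentiableAt (by simp)
  have h : ∀ k i j, pd k (fun z => coordForm F e z i j) y
      = pd k (pd i (b j)) y - pd k (pd j (b i)) y := by
    intro k i j
    rw [pd_congr (g := pd i (b j) - pd j (b i)) (hFb.mono fun z hz => hz i j), pd,
      fderiv_sub (hpd i j) (hpd j i)]
    rfl
  have hc : ∀ i j k, pd i (pd j (b k)) y = pd j (pd i (b k)) y := fun i j k =>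
    pd_comm (hb k).self_of_nhds i j
  rw [h, h, h, hc k i j, hc k j i, hc i j k]
  ring

end Curvature

/-! ### Riemannian metrics in coordinates -/

section Metric

open Matrix

variable {n : ℕ} {M : Type*} [TopologicalSpace M] [ChartedSpace (Euc n) M]

theorem coordForm_eq (F : TwoForm n M) (e : OpenPartialHomeomorph M (Euc n)) (y v w : Euc n) :
    v ⬝ᵥ (coordForm F e y *ᵥ w)
      = F (e.symm y) (mfderiv (𝓡 n) (𝓡 n) e.symm y v) (mfderiv (𝓡 n) (𝓡 n) e.symm y w) := by
  set D : Euc n →L[ℝ] TangentSpace (𝓡 n) (e.symm y) := mfderiv (𝓡 n) (𝓡 n) e.symm y with hD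
  have hsum : ∀ u : Euc n, u = ∑ i, u i • EuclideanSpace.single i (1 : ℝ) := fun u => by
    conv_lhs => rw [← (EuclideanSpace.basisFun (Fin n) ℝ).sum_repr u]
    simp
  have h : F (e.symm y) (D v) (D w) = ∑ i, ∑ j, v i * (w j * coordForm F e y i j) := by
    conv_lhs => rw [hsum v, hsum w]
    simp only [map_sum, map_smul, _root_.sum_apply, _root_.smul_apply,
      smul_eq_mul, Finset.mul_sum]
    rw [Finset.sum_comm]
    refine Finset.sum_congr rfl fun i _ => Finset.sum_congr rfl fun j _ => ?_
    rw [mul_left_comm]; rfl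
  refine Eq.trans ?_ h.symm
  simp only [dotProduct, mulVec, Finset.mul_sum]
  exact Finset.sum_congr rfl fun i _ => Finset.sum_congr rfl fun j _ => by ring

variable [IsManifold (𝓡 n) ∞ M]

theorem contDiffOn_coordMetric (g : EYM.Metric n M) {e : OpenPartialHomeomorph M (Euc n)}
    (he : e ∈ IsManifold.maximalAtlas (𝓡 n) ∞ M) (i j : Fin n) :
    ContDiffOn ℝ ∞ (fun y => coordMetric g e y i j) e.target := fun _ hy =>
  (contDiffAt_bilinear_comp g.contMDiff (contMDiffAt_symm_of_mem_maximalAtlas he hy)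
    _ _).contDiffWithinAt

theorem posDef_coordMetric (g : EYM.Metric n M) {e : OpenPartialHomeomorph M (Euc n)}
    (he : e.MDifferentiable (𝓡 n) (𝓡 n)) {y : Euc n} (hy : y ∈ e.target) :
    (coordMetric g e y).PosDef := by
  refine .of_dotProduct_mulVec_pos ?_ fun v hv => ?_
  · ext i j
    exact g.symm _ _ _
  · have h := coordForm_eq g.inner e y (WithLp.toLp 2 v) (WithLp.toLp 2 v)
    refine lt_of_lt_of_eq (g.pos (e.symm y) _ fun h0 => hv ?_) h.symm
    have h1 : (WithLp.toLp 2 v : Euc n) = 0 :=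
      (DFunLike.congr_fun (he.comp_symm_deriv hy) (WithLp.toLp 2 v)).symm.trans
        ((congrArg (mfderiv (𝓡 n) (𝓡 n) e (e.symm y)) h0).trans (map_zero _))
    exact congrArg WithLp.ofLp h1

omit [IsManifold (𝓡 n) ∞ M] in
/-- The change of the components of a bilinear form under a change of coordinates. -/
theorem exists_coordForm_eq {e e' : OpenPartialHomeomorph M (Euc n)}
    (he : e.MDifferentiable (𝓡 n) (𝓡 n)) {x : M} (hx : x ∈ e.source) (hx' : x ∈ e'.source) :
    ∃ J : Matrix (Fin n) (Fin n) ℝ, ∀ F : TwoForm n M,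
      coordForm F e' (e' x) = Jᵀ * coordForm F e (e x) * J := by
  set K : Fin n → Euc n := fun i => mfderiv (𝓡 n) (𝓡 n) e x
    (mfderiv (𝓡 n) (𝓡 n) e'.symm (e' x) (EuclideanSpace.single i (1 : ℝ)) : Euc n) with hK
  refine ⟨Matrix.of fun k i => K i k, fun F => ?_⟩
  have hD : ∀ i, (mfderiv (𝓡 n) (𝓡 n) e'.symm (e' x) (EuclideanSpace.single i (1 : ℝ)) : Euc n)
      = mfderiv (𝓡 n) (𝓡 n) e.symm (e x) (K i) := fun i =>
    (DFunLike.congr_fun (he.symm_comp_deriv hx) (mfderiv (𝓡 n) (𝓡 n) e'.symm (e' x)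
      (EuclideanSpace.single i (1 : ℝ)) : Euc n)).symm
  have hp : e'.symm (e' x) = e.symm (e x) := by rw [e.left_inv hx, e'.left_inv hx']
  ext i j
  have h1 : coordForm F e' (e' x) i j
      = F (e.symm (e x)) (mfderiv (𝓡 n) (𝓡 n) e.symm (e x) (K i))
        (mfderiv (𝓡 n) (𝓡 n) e.symm (e x) (K j)) := twoForm_congr F hp (hD i) (hD j)
  rw [h1, ← coordForm_eq, mul_assoc, mul_apply]
  simp only [dotProduct, mulVec, mul_apply]
  rfl

/-- A change of frame conjugates `G⁻¹ Ω G⁻¹ Ωᵀ` by `J`, which leaves its trace unchanged. -/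
theorem tensorNormSq_two_congr {G Ω J : Matrix (Fin n) (Fin n) ℝ} (hG : Gᵀ = G)
    (hJ : (Jᵀ * G * J).det ≠ 0) :
    tensorNormSq (Jᵀ * G * J)⁻¹ (fun I : Fin 2 → Fin n => (Jᵀ * Ω * J) (I 0) (I 1))
      = tensorNormSq G⁻¹ (fun I : Fin 2 → Fin n => Ω (I 0) (I 1)) := by
  have hJ' : IsUnit J.det := by
    rw [det_mul] at hJ
    exact isUnit_iff_ne_zero.2 (right_ne_zero_of_mul hJ)
  have hJt : IsUnit Jᵀ.det := by rwa [det_transpose]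
  have h1 : (Jᵀ * G * J)ᵀ = Jᵀ * G * J := by
    rw [transpose_mul, transpose_mul, transpose_transpose, hG, mul_assoc]
  rw [tensorNormSq_two _ _ (by rw [transpose_nonsing_inv, h1]),
    tensorNormSq_two _ _ (by rw [transpose_nonsing_inv, hG]), Matrix.mul_inv_rev,
    Matrix.mul_inv_rev,
    transpose_mul, transpose_mul, transpose_transpose]
  have h2 : J⁻¹ * (G⁻¹ * Jᵀ⁻¹) * (Jᵀ * Ω * J) * (J⁻¹ * (G⁻¹ * Jᵀ⁻¹) * (Jᵀ * (Ωᵀ * J)))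
      = J⁻¹ * (G⁻¹ * Ω * (G⁻¹ * Ωᵀ) * J) := by
    calc _ = J⁻¹ * G⁻¹ * (Jᵀ⁻¹ * Jᵀ) * Ω * (J * J⁻¹) * G⁻¹ * (Jᵀ⁻¹ * Jᵀ) * Ωᵀ * J := by
          noncomm_ring
      _ = _ := by
          rw [nonsing_inv_mul _ hJt, mul_nonsing_inv _ hJ']
          noncomm_ring
  rw [h2, trace_mul_comm, mul_assoc, mul_nonsing_inv _ hJ', mul_one]

/-- `|F|²` may be computed in any chart. -/
theorem formNormSq_eq (g : EYM.Metric n M) (F : TwoForm n M) (x₀ : M) {x : M}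
    (hx : x ∈ (chartAt (Euc n) x₀).source) :
    formNormSq g F x = tensorNormSq
      (coordMetric g (chartAt (Euc n) x₀) (chartAt (Euc n) x₀ x))⁻¹
      (fun I : Fin 2 → Fin n =>
        coordForm F (chartAt (Euc n) x₀) (chartAt (Euc n) x₀ x) (I 0) (I 1)) := by
  have h1 : IsManifold (𝓡 n) 1 M := .of_le (n := ∞) (by simp)
  have hd : ∀ x : M, (chartAt (Euc n) x).MDifferentiable (𝓡 n) (𝓡 n) := fun x =>
    mdifferentiable_chart x
  obtain ⟨J, hJ⟩ := exists_coordForm_eq (hd x₀) hx (mem_chart_source (Euc n) x)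
  have hpos := posDef_coordMetric g (hd x) (mem_chart_target (Euc n) x)
  have hpos₀ := posDef_coordMetric g (hd x₀) ((chartAt (Euc n) x₀).map_source hx)
  simp only [formNormSq]
  rw [coordMetric, hJ] at hpos
  rw [coordMetric, coordMetric, hJ, hJ]
  have hs := hpos₀.1.eq
  rw [conjTranspose_eq_transpose_of_trivial] at hs
  exact tensorNormSq_two_congr hs hpos.det_pos.ne'

end Metric

/-! ### Einstein Yang-Mills systems -/

section System

variable {n : ℕ} {M : Type*} [TopologicalSpace M] [ChartedSpace (Euc n) M]
  [IsManifold (𝓡 n) ∞ M]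
  {P : Type*} [TopologicalSpace P] [ChartedSpace (Euc (n + 1)) P] [IsManifold (𝓡 (n + 1)) ∞ P]
  [MulAction Circle P] {pr : P → M} {g : Metric n M} {A : OneForm (n + 1) P} {F : TwoForm n M}
  {lam : ℝ}

namespace IsEYMSystem

variable (h : IsEYMSystem pr g A F lam)
include h

theorem isLocalEYM (x : M) :
    IsLocalEYM ⟨(chartAt (Euc n) x).target, (chartAt (Euc n) x).open_target⟩
      (coordMetric g (chartAt (Euc n) x)) (coordForm F (chartAt (Euc n) x)) lam := by
  have h1 : IsManifold (𝓡 n) 1 M := .of_le (n := ∞) (by simp)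
  have he : chartAt (Euc n) x ∈ IsManifold.maximalAtlas (𝓡 n) ∞ M :=
    IsManifold.chart_mem_maximalAtlas x
  exact
    { smooth_metric := contDiffOn_coordMetric g he
      posDef := fun y hy => posDef_coordMetric g (mdifferentiable_chart x) hy
      smooth_form := contDiffOn_coordForm h.bundle h.connection h.curvature he
      alt := fun y hy => coordForm_alt h.bundle h.connection h.curvature he hy
      closed := fun y hy => coordForm_closed h.bundle h.connection h.curvature he hy
      einstein := h.einstein _ he
      coclosed := h.yangMills _ he }

/-- `formNormSq` uses a chart that varies with the point, so nearby values are first moved to one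
fixed chart; there the derivative vanishes on a ball. -/
theorem isLocallyConstant_formNormSq : IsLocallyConstant (formNormSq g F) := by
  rw [IsLocallyConstant.iff_eventually_eq]
  intro x
  set e := chartAt (Euc n) x with he
  obtain ⟨r, hr, hball⟩ := Metric.isOpen_iff.1 e.open_target (e x) (mem_chart_target (Euc n) x)
  set ψ : Euc n → ℝ := fun z => tensorNormSq (coordMetric g e z)⁻¹
    (fun I : Fin 2 → Fin n => coordForm F e z (I 0) (I 1))
  have hconst : ∀ z ∈ Metric.ball (e x) r, ∀ w ∈ Metric.ball (e x) r, ψ z = ψ w :=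
    fun z hz w hw => (convex_ball (e x) r).is_const_of_fderivWithin_eq_zero (𝕜 := ℝ) (f := ψ)
    (fun z hz => ((h.isLocalEYM x).fderiv_tensorNormSq_form
      (hball hz)).differentiableAt.differentiableWithinAt)
    (fun z hz => ((h.isLocalEYM x).fderiv_tensorNormSq_form
      (hball hz)).hasFDerivWithinAt.fderivWithin (Metric.isOpen_ball.uniqueDiffWithinAt hz)) hz hw
  filter_upwards [e.open_source.mem_nhds (mem_chart_source (Euc n) x),
    (e.continuousAt (mem_chart_source (Euc n) x)).eventually (Metric.ball_mem_nhds _ hr)]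
    with x' hx' hb
  rw [formNormSq_eq g F x hx', formNormSq_eq g F x (mem_chart_source (Euc n) x)]
  exact hconst _ hb _ (Metric.mem_ball_self hr)

/-- All three norms at `x` are defined by the chart at `x`, so the local estimate applies directly.
-/
theorem nablaNormSq_le (hlam : |lam| ≤ 1) (x : M) :
    nablaNormSq g F x ≤ 2 * formNormSq g F x * (Real.sqrt (riemannNormSq g x) + 1) :=
  (h.isLocalEYM x).tensorNormSq_nabla_le hlam (mem_chart_target (Euc n) x)

theorem formNormSq_nonneg (x : M) : 0 ≤ formNormSq g F x :=
  tensorNormSq_nonneg ((h.isLocalEYM x).posDef _ (mem_chart_target (Euc n) x)).inv.posSemidef _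

theorem nablaNormSq_nonneg (x : M) : 0 ≤ nablaNormSq g F x :=
  tensorNormSq_nonneg ((h.isLocalEYM x).posDef _ (mem_chart_target (Euc n) x)).inv.posSemidef _

end IsEYMSystem

end System

/-! ### Integral estimates -/

/-- Minkowski's inequality for the sum of an arbitrary function and a constant. -/
theorem lintegral_rpow_add_const_le {α : Type*} [MeasurableSpace α] (μ : Measure α)
    (u : α → ENNReal) (c : ENNReal) {p : ℝ} (hp : 1 ≤ p) :
    (∫⁻ x, (u x + c) ^ p ∂μ) ^ (1 / p)
      ≤ (∫⁻ x, u x ^ p ∂μ) ^ (1 / p) + c * μ Set.univ ^ (1 / p) := by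
  have hp0 : 0 < p := by linarith
  have hp1 : 0 ≤ 1 / p := by positivity
  -- Without measurability of `u`, replace the integrand by a measurable minorant `h` with the same
  -- integral; `v = h^(1/p) - c` (truncated) is then a measurable minorant of `u`.
  obtain ⟨h, hm, hle, heq⟩ := exists_measurable_le_lintegral_eq μ fun x => (u x + c) ^ p
  have hroot : ∀ x, h x ^ (1 / p) ≤ u x + c := fun x => by
    calc h x ^ (1 / p) ≤ ((u x + c) ^ p) ^ (1 / p) := ENNReal.rpow_le_rpow (hle x) hp1
      _ = u x + c := by rw [one_div, ENNReal.rpow_rpow_inv hp0.ne']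
  set v : α → ENNReal := fun x => h x ^ (1 / p) - c with hv
  have hvm : Measurable v := (hm.pow_const _).sub_const c
  have hvu : ∀ x, v x ≤ u x := fun x => tsub_le_iff_right.2 (hroot x)
  have hhv : ∀ x, h x ≤ (v x + c) ^ p := fun x => by
    calc h x = (h x ^ (1 / p)) ^ p := by rw [one_div, ENNReal.rpow_inv_rpow hp0.ne']
      _ ≤ (v x + c) ^ p := ENNReal.rpow_le_rpow le_tsub_add hp0.le
  have hc : (∫⁻ _, c ^ p ∂μ) ^ (1 / p) = c * μ Set.univ ^ (1 / p) := by
    rw [lintegral_const, ENNReal.mul_rpow_of_nonneg _ _ hp1, one_div,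
      ENNReal.rpow_rpow_inv hp0.ne']
  calc (∫⁻ x, (u x + c) ^ p ∂μ) ^ (1 / p) = (∫⁻ x, h x ∂μ) ^ (1 / p) := by rw [heq]
    _ ≤ (∫⁻ x, (v + Function.const α c) x ^ p ∂μ) ^ (1 / p) :=
        ENNReal.rpow_le_rpow (lintegral_mono hhv) hp1
    _ ≤ (∫⁻ x, v x ^ p ∂μ) ^ (1 / p) + (∫⁻ _, c ^ p ∂μ) ^ (1 / p) :=
        ENNReal.lintegral_Lp_add_le hvm.aemeasurable aemeasurable_const hp
    _ ≤ _ := by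
        rw [hc]
        gcongr with x
        exact hvu x

theorem ofReal_sqrt_rpow {a : ℝ} (ha : 0 ≤ a) (p : ℝ) :
    ENNReal.ofReal (Real.sqrt a) ^ (2 * p) = ENNReal.ofReal a ^ p := by
  rw [ENNReal.rpow_mul, ENNReal.rpow_two, ← ENNReal.ofReal_pow (Real.sqrt_nonneg a),
    Real.sq_sqrt ha]

theorem rpow_le_ofReal_max {m : ENNReal} {V p : ℝ} (hp : 0 < p) (hm : m ≤ ENNReal.ofReal V) :
    m ^ (1 / p) ≤ ENNReal.ofReal (max 1 (2 * V ^ (1 / p))) := by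
  have hp1 : 0 < 1 / p := by positivity
  rcases le_total 0 V with hV | hV
  · calc m ^ (1 / p) ≤ ENNReal.ofReal V ^ (1 / p) := ENNReal.rpow_le_rpow hm hp1.le
      _ = ENNReal.ofReal (V ^ (1 / p)) := ENNReal.ofReal_rpow_of_nonneg hV hp1.le
      _ ≤ _ := by
        refine ENNReal.ofReal_le_ofReal (le_trans ?_ (le_max_right _ _))
        have := Real.rpow_nonneg hV (1 / p)
        linarith
  · rw [ENNReal.ofReal_of_nonpos hV, nonpos_iff_eq_zero] at hm
    rw [hm, ENNReal.zero_rpow_of_pos hp1]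
    exact zero_le

section System

variable {n : ℕ} {M : Type*} [TopologicalSpace M] [ChartedSpace (Euc n) M]
  [IsManifold (𝓡 n) ∞ M] [MeasurableSpace M]
  {P : Type*} [TopologicalSpace P] [ChartedSpace (Euc (n + 1)) P] [IsManifold (𝓡 (n + 1)) ∞ P]
  [MulAction Circle P] {pr : P → M} {g : Metric n M} {A : OneForm (n + 1) P} {F : TwoForm n M}
  {lam : ℝ}

namespace IsEYMSystem

variable (h : IsEYMSystem pr g A F lam) {p V f : ℝ}
include h

/-- Minkowski for `|Rm| + 1`. The maximum dominates both the coefficient 1 of the curvature norm and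
`Vol^(1/p)`. -/
theorem lintegral_nabla_le (hlam : |lam| ≤ 1) (hp : 1 < p)
    (hV : volumeMeasure g Set.univ ≤ ENNReal.ofReal V) (hf0 : 0 ≤ f)
    (hf : ∀ x, formNormSq g F x = f) :
    (∫⁻ x, ENNReal.ofReal (Real.sqrt (nablaNormSq g F x)) ^ (2 * p) ∂(volumeMeasure g)) ^ (1 / p)
      ≤ ENNReal.ofReal (2 * max 1 (2 * V ^ (1 / p)) * f) *
        (1 + lpNorm g p (fun x => Real.sqrt (riemannNormSq g x))) := by
  have hp0 : 0 < p := by linarith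
  have hp1 : 0 ≤ 1 / p := by positivity
  set u : M → ENNReal := fun x => ENNReal.ofReal (Real.sqrt (riemannNormSq g x)) with hu
  set m := max 1 (2 * V ^ (1 / p)) with hm
  have hm1 : 1 ≤ m := le_max_left _ _
  have hpt : ∀ x, ENNReal.ofReal (Real.sqrt (nablaNormSq g F x)) ^ (2 * p)
      ≤ ENNReal.ofReal (2 * f) ^ p * (u x + 1) ^ p := by
    intro x
    rw [ofReal_sqrt_rpow (h.nablaNormSq_nonneg x), ← ENNReal.mul_rpow_of_nonneg _ _ hp0.le]
    refine ENNReal.rpow_le_rpow ?_ hp0.le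
    rw [hu, ← ENNReal.ofReal_one, ← ENNReal.ofReal_add (Real.sqrt_nonneg _) zero_le_one,
      ← ENNReal.ofReal_mul (by linarith), ← hf x]
    exact ENNReal.ofReal_le_ofReal (h.nablaNormSq_le hlam x)
  have hone : (1 : ENNReal) ≤ ENNReal.ofReal m := by
    rw [← ENNReal.ofReal_one]; exact ENNReal.ofReal_le_ofReal hm1
  calc _ ≤ (∫⁻ x, ENNReal.ofReal (2 * f) ^ p * (u x + 1) ^ p ∂(volumeMeasure g)) ^ (1 / p) :=
        ENNReal.rpow_le_rpow (lintegral_mono hpt) hp1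
    _ = ENNReal.ofReal (2 * f)
          * (∫⁻ x, (u x + 1) ^ p ∂(volumeMeasure g)) ^ (1 / p) := by
        rw [lintegral_const_mul' _ _ (ENNReal.rpow_ne_top_of_nonneg hp0.le ENNReal.ofReal_ne_top),
          ENNReal.mul_rpow_of_nonneg _ _ hp1, one_div, ENNReal.rpow_rpow_inv hp0.ne']
    _ ≤ ENNReal.ofReal (2 * f) * ((∫⁻ x, u x ^ p ∂(volumeMeasure g)) ^ (1 / p)
          + 1 * volumeMeasure g Set.univ ^ (1 / p)) := by
        gcongr
        exact lintegral_rpow_add_const_le _ u 1 hp.le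
    _ ≤ ENNReal.ofReal (2 * f) * (ENNReal.ofReal m * (∫⁻ x, u x ^ p ∂(volumeMeasure g)) ^ (1 / p)
          + ENNReal.ofReal m) := by
        gcongr
        · exact le_mul_of_one_le_left (zero_le) hone
        · rw [one_mul]; exact rpow_le_ofReal_max hp0 hV
    _ = ENNReal.ofReal (2 * m * f) * (1 + lpNorm g p fun x => Real.sqrt (riemannNormSq g x)) := by
        rw [show 2 * m * f = 2 * f * m by ring, ENNReal.ofReal_mul (by linarith : 0 ≤ 2 * f),
          lpNorm]
        ring

theorem sobolevNorm_sq_le (hlam : |lam| ≤ 1) (hp : 1 < p)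
    (hV : volumeMeasure g Set.univ ≤ ENNReal.ofReal V) (hf0 : 0 ≤ f)
    (hf : ∀ x, formNormSq g F x = f) :
    sobolevNorm g (2 * p) F ^ 2
      ≤ ENNReal.ofReal (3 * max 1 (2 * V ^ (1 / p)) * f) *
        (1 + lpNorm g p (fun x => Real.sqrt (riemannNormSq g x))) := by
  have hp0 : 0 < p := by linarith
  have hp1 : 0 ≤ 1 / p := by positivity
  have hm0 : 0 ≤ max 1 (2 * V ^ (1 / p)) := zero_le_one.trans (le_max_left _ _)
  have ha : (∫⁻ x, ENNReal.ofReal (Real.sqrt (formNormSq g F x)) ^ (2 * p)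
      ∂(volumeMeasure g)) ^ (1 / p) ≤ ENNReal.ofReal (max 1 (2 * V ^ (1 / p)) * f) := by
    simp only [hf, ofReal_sqrt_rpow hf0, lintegral_const]
    rw [ENNReal.mul_rpow_of_nonneg _ _ hp1, one_div, ENNReal.rpow_rpow_inv hp0.ne', ← one_div,
      mul_comm, ENNReal.ofReal_mul hm0]
    gcongr
    exact rpow_le_ofReal_max hp0 hV
  have hb := h.lintegral_nabla_le hlam hp hV hf0 hf
  set B := 1 + lpNorm g p fun x => Real.sqrt (riemannNormSq g x) with hB
  have hB1 : 1 ≤ B := le_self_add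
  rw [sobolevNorm, ← ENNReal.rpow_two, ← ENNReal.rpow_mul,
    show 1 / (2 * p) * 2 = 1 / p by field_simp]
  -- Squaring turns the exponent `1/(2p)` into `1/p ≤ 1`, a subadditive power. The `F` part
  -- contributes 1 and the `∇F` part 2 to the constant 3.
  calc _ ≤ _ := ENNReal.rpow_add_le_add_rpow _ _ hp1 ((div_le_one hp0).2 hp.le)
    _ ≤ ENNReal.ofReal (max 1 (2 * V ^ (1 / p)) * f) * B
        + ENNReal.ofReal (2 * max 1 (2 * V ^ (1 / p)) * f) * B :=
      add_le_add (ha.trans (le_mul_of_one_le_right (zero_le) hB1)) hb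
    _ = _ := by
      rw [← add_mul, ← ENNReal.ofReal_add (by positivity) (by positivity)]
      congr 2; ring

end IsEYMSystem

end System

end EYM

end

theorem proposition1 :
    ∃ C : ℝ → ℝ → ℝ → ℝ, (∀ p V f : ℝ, 0 < C p V f) ∧
      ∀ (p V : ℝ), 1 < p →
      ∀ (n : ℕ) (M : Type*) [TopologicalSpace M] [T2Space M] [CompactSpace M] [ConnectedSpace M]
        [ChartedSpace (EYM.Euc n) M] [IsManifold (𝓡 n) ∞ M] [MeasurableSpace M] [BorelSpace M]
        (P : Type*) [TopologicalSpace P] [ChartedSpace (EYM.Euc (n + 1)) P]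
        [IsManifold (𝓡 (n + 1)) ∞ P] [MulAction Circle P]
        (pr : P → M) (g : EYM.Metric n M) (A : EYM.OneForm (n + 1) P) (F : EYM.TwoForm n M)
        (lam : ℝ),
        EYM.IsEYMSystem pr g A F lam → |lam| ≤ 1 →
        EYM.volumeMeasure g Set.univ ≤ ENNReal.ofReal V →
        ∃ f : ℝ, (∀ x : M, EYM.formNormSq g F x = f) ∧
          (∫⁻ x, ENNReal.ofReal (Real.sqrt (EYM.nablaNormSq g F x)) ^ (2 * p)
              ∂(EYM.volumeMeasure g)) ^ (1 / p)
            ≤ ENNReal.ofReal (2 * max 1 (2 * V ^ (1 / p)) * f) *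
              (1 + EYM.lpNorm g p (fun x => Real.sqrt (EYM.riemannNormSq g x))) ∧
          EYM.sobolevNorm g (2 * p) F ^ 2
            ≤ ENNReal.ofReal (C p V f) *
              (1 + EYM.lpNorm g p (fun x => Real.sqrt (EYM.riemannNormSq g x))) := by
  -- The absolute value and the summand 1 only serve positivity of `C` at all real arguments.
  refine ⟨fun p V f => 3 * max 1 (2 * V ^ (1 / p)) * |f| + 1, fun p V f => ?_, ?_⟩
  · have : 0 ≤ max 1 (2 * V ^ (1 / p)) := zero_le_one.trans (le_max_left _ _)
    positivity
  · intro p V hp n M _ _ _ _ _ _ _ _ P _ _ _ _ pr g A F lam h hlam hV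
    obtain ⟨x₀⟩ := (inferInstance : Nonempty M)
    have hf : ∀ x, EYM.formNormSq g F x = EYM.formNormSq g F x₀ := fun x =>
      h.isLocallyConstant_formNormSq.apply_eq_of_preconnectedSpace x x₀
    have hf0 := h.formNormSq_nonneg x₀
    refine ⟨EYM.formNormSq g F x₀, hf, h.lintegral_nabla_le hlam hp hV hf0 hf,
      (h.sobolevNorm_sq_le hlam hp hV hf0 hf).trans ?_⟩
    gcongr
    simp only [abs_of_nonneg hf0]
    linarith
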